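/- Let $G$ be a compact Lie group whose Killing form $B$ is negative definite (i.e. $G$ is semisimple), put $\langle\cdot,\cdot\rangle=-B$ on the Lie algebra $\mathfrak g$, let $H\subset G$ be a closed subgroup with Lie algebra $\mathfrak h$, and give $G/H$ its usual structure of a smooth manifold, of dimension $n$. Suppose that $G/H$ is a generalized Wallach space: the $\langle\cdot,\cdot\rangle$-orthogonal complement $\mathfrak p$ of $\mathfrak h$ is a direct sum $\mathfrak p=\mathfrak p_1\oplus\mathfrak p_2\oplus\mathfrak p_3$ of three pairwise orthogonal, irreducible $\mathrm{Ad}(H)$-modules with $[\mathfrak p_i,\mathfrak p_i]\subset\mathfrak h$ for $i=1,2,3$. Let $a_i=A/\dim\mathfrak p_i$, where $A=\sum_{\alpha,\beta,\gamma}\langle[e_1^\alpha,e_2^\beta],e_3^\gamma\rangle^2$ for $\langle\cdot,\cdot\rangle$-orthonormal bases $(e_i^\alpha)_\alpha$ of $\mathfrak p_i$, and suppose that $a_1=a_2=a_3=\tfrac16$. For $x_1,x_2,x_3>0$ consider the $G$-invariant Riemannian metric on $G/H$ determined by the inner product $$(\cdot,\cdot)=x_1\langle\cdot,\cdot\rangle|_{\mathfrak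 p_1}+x_2\langle\cdot,\cdot\rangle|_{\mathfrak p_2}+x_3\langle\cdot,\cdot\rangle|_{\mathfrak p_3}\qquad(*)$$ on $\mathfrak p\cong T_{eH}(G/H)$. Let $\mathbf g(t)$, $t\in[0,T)$, be a solution, consisting of metrics of the form $(*)$ with parameters $x_i(t)$, of the normalized Ricci flow $$\frac{\partial}{\partial t}\mathbf g(t)=-2\,\mathrm{Ric}_{\mathbf g(t)}+2\,\mathbf g(t)\frac{S_{\mathbf g(t)}}{n},$$ where $\mathrm{Ric}$ and $S$ are the Ricci tensor and the scalar curvature. If $x_k(0)<x_i(0)+x_j(0)$ for all indices with $\{i,j,k\}=\{1,2,3\}$, then $\mathbf g(t)$ has positive Ricci curvature for every $t\in[0,T)$. -/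

import Mathlib

open Set Bundle
open scoped Manifold ContDiff

noncomputable section

namespace Wallach

/-! ### Riemannian geometry: Levi-Civita connection, curvature, Ricci flow -/

section Riemannian

variable {n : ℕ} {M : Type*} [TopologicalSpace M] [ChartedSpace (EuclideanSpace ℝ (Fin n)) M]
  [IsManifold (𝓡 n) ∞ M]

variable (n M) in
/-- Smooth Riemannian metrics on the `n`-dimensional manifold `M`. -/
abbrev Metric : Type _ :=
  ContMDiffRiemannianMetric (𝓡 n) ∞ (EuclideanSpace ℝ (Fin n)) (TangentSpace (𝓡 n) : M → Type _)

variable (n M) in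
/-- Covariant derivatives on the tangent bundle. On paper `cov Y x (X x)` is `(∇_X Y)(x)`. -/
abbrev Connection : Type _ :=
  CovariantDerivative (𝓡 n) (EuclideanSpace ℝ (Fin n)) (TangentSpace (𝓡 n) : M → Type _)

/-- `X` is a smooth vector field on `M`. -/
def IsSmoothField (X : ∀ y : M, TangentSpace (𝓡 n) y) : Prop :=
  ContMDiff (𝓡 n) ((𝓡 n).prod 𝓘(ℝ, EuclideanSpace ℝ (Fin n))) ∞
    (fun y => (⟨y, X y⟩ : TangentBundle (𝓡 n) M))

/-- `cov` is the Levi-Civita connection of `g`: smooth, torsion free and metric. -/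
structure IsLeviCivita (g : Metric n M) (cov : Connection n M) : Prop where
  smooth : CovariantDerivative.ContMDiffCovariantDerivative cov ∞
  torsion_eq_zero : cov.torsion = 0
  metric : ∀ Y Z : (∀ y : M, TangentSpace (𝓡 n) y), IsSmoothField Y → IsSmoothField Z →
    ∀ (y : M) (v : TangentSpace (𝓡 n) y),
      (mfderiv (𝓡 n) 𝓘(ℝ, ℝ) (fun q => g.inner q (Y q) (Z q)) y v : ℝ) =
        g.inner y (cov Y y v) (Z y) + g.inner y (Y y) (cov Z y v)

/-- `R` is the curvature tensor of `cov`: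
`R(X,Y)Z = ∇_X ∇_Y Z - ∇_Y ∇_X Z - ∇_[X,Y] Z` for all smooth vector fields. -/
def IsCurvatureTensor (cov : Connection n M)
    (R : ∀ y : M, TangentSpace (𝓡 n) y →ₗ[ℝ] TangentSpace (𝓡 n) y →ₗ[ℝ]
      TangentSpace (𝓡 n) y →ₗ[ℝ] TangentSpace (𝓡 n) y) : Prop :=
  ∀ X Y Z : (∀ y : M, TangentSpace (𝓡 n) y),
    IsSmoothField X → IsSmoothField Y → IsSmoothField Z → ∀ y : M,
      R y (X y) (Y y) (Z y) =
        cov (fun q => cov Z q (Y q)) y (X y) - cov (fun q => cov Z q (X q)) y (Y y)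
          - cov Z y (VectorField.mlieBracket (𝓡 n) X Y y)

/-- `Ric` is the Ricci tensor of `g`: `Ric(v,w)` is the trace of `u ↦ R(u,v)w`, where `R` is the
curvature tensor of the Levi-Civita connection of `g`. -/
def IsRicciTensor (g : Metric n M)
    (Ric : ∀ y : M, TangentSpace (𝓡 n) y → TangentSpace (𝓡 n) y → ℝ) : Prop :=
  ∃ cov : Connection n M, IsLeviCivita g cov ∧
    ∃ R : (∀ y : M, TangentSpace (𝓡 n) y →ₗ[ℝ] TangentSpace (𝓡 n) y →ₗ[ℝ]
        TangentSpace (𝓡 n) y →ₗ[ℝ] TangentSpace (𝓡 n) y),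
      IsCurvatureTensor cov R ∧
        ∀ (y : M) (v w : TangentSpace (𝓡 n) y),
          Ric y v w = LinearMap.trace ℝ (TangentSpace (𝓡 n) y) (((R y).flip v).flip w)

/-- `S` is the trace of `Ric` with respect to `g` (the scalar curvature, when `Ric` is the Ricci
tensor of `g`): `S = ∑ Ric(e_i, e_i)` for every `g`-orthonormal basis. -/
def IsScalarCurvature (g : Metric n M)
    (Ric : ∀ y : M, TangentSpace (𝓡 n) y → TangentSpace (𝓡 n) y → ℝ) (S : M → ℝ) : Prop :=
  ∀ (y : M) (e : Module.Basis (Fin n) ℝ (TangentSpace (𝓡 n) y)),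
    (∀ i j, g.inner y (e i) (e j) = if i = j then 1 else 0) → S y = ∑ i, Ric y (e i) (e i)

/-- The Ricci curvature of `g` is positive. -/
def HasPositiveRicci (g : Metric n M) : Prop :=
  ∃ Ric : (∀ y : M, TangentSpace (𝓡 n) y → TangentSpace (𝓡 n) y → ℝ),
    IsRicciTensor g Ric ∧ ∀ (y : M) (v : TangentSpace (𝓡 n) y), v ≠ 0 → 0 < Ric y v v

/-- `g t`, `t ∈ [0, T)`, solves the normalized Ricci flow `∂g/∂t = -2 Ric_g + 2 g S_g / n`. -/
def IsNormalizedRicciFlow (T : ℝ) (g : ℝ → Metric n M) : Prop :=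
  ∀ t ∈ Ico (0 : ℝ) T,
    ∃ (Ric : ∀ y : M, TangentSpace (𝓡 n) y → TangentSpace (𝓡 n) y → ℝ) (S : M → ℝ),
      IsRicciTensor (g t) Ric ∧ IsScalarCurvature (g t) Ric S ∧
        ∀ (y : M) (v w : TangentSpace (𝓡 n) y),
          HasDerivWithinAt (fun s => (g s).inner y v w)
            (-2 * Ric y v w + 2 * (g t).inner y v w * (S y / n)) (Ico 0 T) t

end Riemannian

/-! ### Homogeneous spaces and generalized Wallach spaces -/

section Homogeneous

variable {m : ℕ} {G : Type*} [TopologicalSpace G] [ChartedSpace (EuclideanSpace ℝ (Fin m)) G]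
  [Group G]

/-- Lets the Lie algebra structure on the tangent space at `1` be found for smooth Lie groups. -/
instance lieGroupMinSmoothness [LieGroup (𝓡 m) ∞ G] : LieGroup (𝓡 m) (minSmoothness ℝ 3) G :=
  LieGroup.of_le (n := ∞) (by rw [minSmoothness_of_isRCLikeNormedField]; exact ENat.LEInfty.out)

/-- The adjoint action of `h` on the Lie algebra: the differential at `1` of `q ↦ h q h⁻¹`
(which fixes `1`). -/
def Ad (h : G) : GroupLieAlgebra (𝓡 m) G → GroupLieAlgebra (𝓡 m) G :=
  fun X => (mfderiv (𝓡 m) (𝓡 m) (fun q : G => h * q * h⁻¹) 1 : _ → _) X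

/-- The inner product `-B` on the Lie algebra, where `B` is the Killing form. -/
def negKilling [LieGroup (𝓡 m) ∞ G] (X Y : GroupLieAlgebra (𝓡 m) G) : ℝ :=
  -killingForm ℝ (GroupLieAlgebra (𝓡 m) G) X Y

variable {n : ℕ} (H : Subgroup G) [ChartedSpace (EuclideanSpace ℝ (Fin n)) (G ⧸ H)]

/-- The manifold structure on `G ⧸ H` is that of the homogeneous space: the projection `G → G ⧸ H`
is a smooth submersion and `G` acts smoothly. -/
structure IsHomogeneousManifold (m n : ℕ) {G : Type*} [TopologicalSpace G]
    [ChartedSpace (EuclideanSpace ℝ (Fin m)) G] [Group G] (H : Subgroup G)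
    [ChartedSpace (EuclideanSpace ℝ (Fin n)) (G ⧸ H)] : Prop where
  smooth_mk : ContMDiff (𝓡 m) (𝓡 n) ∞ (fun a : G => (a : G ⧸ H))
  submersion : ∀ a : G,
    Function.Surjective (mfderiv (𝓡 m) (𝓡 n) (fun b : G => (b : G ⧸ H)) a)
  smooth_smul : ContMDiffSMul (𝓡 m) (𝓡 n) ∞ G (G ⧸ H)

/-- The differential at `1` of the projection `G → G ⧸ H`. -/
def dproj (n : ℕ) (H : Subgroup G) [ChartedSpace (EuclideanSpace ℝ (Fin n)) (G ⧸ H)] :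
    GroupLieAlgebra (𝓡 m) G →L[ℝ] TangentSpace (𝓡 n) ((1 : G) : G ⧸ H) :=
  mfderiv (𝓡 m) (𝓡 n) (fun a : G => (a : G ⧸ H)) 1

/-- The Lie algebra of `H`, as a subspace of the Lie algebra of `G`: the vectors tangent at `1` to
the fibre `H` of the submersion `G → G ⧸ H`. -/
def isotropyAlgebra (n : ℕ) (H : Subgroup G) [ChartedSpace (EuclideanSpace ℝ (Fin n)) (G ⧸ H)] :
    Submodule ℝ (GroupLieAlgebra (𝓡 m) G) :=
  LinearMap.ker (dproj (m := m) n H).toLinearMap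

/-- `W` is invariant under `Ad(H)`. -/
def IsAdInvariant (H : Subgroup G) (W : Submodule ℝ (GroupLieAlgebra (𝓡 m) G)) : Prop :=
  ∀ h ∈ H, ∀ X ∈ W, Ad h X ∈ W

/-- `G ⧸ H` is a generalized Wallach space with modules `p 0, p 1, p 2`: the Killing form of `G` is
negative definite (`G` is semisimple), `H` is closed, and the orthogonal complement of the Lie
algebra of `H` with respect to `-B` is the orthogonal sum of the three irreducible
`Ad(H)`-modules `p i`, which satisfy `[p i, p i] ⊆ 𝔥`. -/
structure IsGeneralizedWallach (n : ℕ) [LieGroup (𝓡 m) ∞ G] (H : Subgroup G)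
    [ChartedSpace (EuclideanSpace ℝ (Fin n)) (G ⧸ H)]
    (p : Fin 3 → Submodule ℝ (GroupLieAlgebra (𝓡 m) G)) : Prop where
  isClosed : IsClosed (H : Set G)
  homogeneous : IsHomogeneousManifold m n H
  pos : ∀ X : GroupLieAlgebra (𝓡 m) G, X ≠ 0 → 0 < negKilling X X
  sum_eq : ∀ X : GroupLieAlgebra (𝓡 m) G,
    X ∈ ⨆ i, p i ↔ ∀ Y ∈ isotropyAlgebra n H, negKilling X Y = 0
  orthogonal : ∀ i j, i ≠ j → ∀ X ∈ p i, ∀ Y ∈ p j, negKilling X Y = 0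
  invariant : ∀ i, IsAdInvariant H (p i)
  ne_bot : ∀ i, p i ≠ ⊥
  irreducible : ∀ i, ∀ W ≤ p i, IsAdInvariant H W → W = ⊥ ∨ W = p i
  bracket_mem : ∀ i, ∀ X ∈ p i, ∀ Y ∈ p i, ⁅X, Y⁆ ∈ isotropyAlgebra n H

/-- `e i` is a basis of `p i`, orthonormal with respect to `-B`, for each `i`. -/
def AreOrthonormal [LieGroup (𝓡 m) ∞ G] {p : Fin 3 → Submodule ℝ (GroupLieAlgebra (𝓡 m) G)}
    {d : Fin 3 → ℕ} (e : ∀ i, Module.Basis (Fin (d i)) ℝ (p i)) : Prop :=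
  ∀ i α β, negKilling (e i α : GroupLieAlgebra (𝓡 m) G) (e i β) = if α = β then 1 else 0

/-- The constant `a_i = A / dim p_i`, where `A = ∑ ⟨[e_1^α, e_2^β], e_3^γ⟩²` is computed in
orthonormal bases of the three modules. -/
def wallachConstant [LieGroup (𝓡 m) ∞ G] {p : Fin 3 → Submodule ℝ (GroupLieAlgebra (𝓡 m) G)}
    {d : Fin 3 → ℕ} (e : ∀ i, Module.Basis (Fin (d i)) ℝ (p i)) (i : Fin 3) : ℝ :=
  (∑ α, ∑ β, ∑ γ,
    (negKilling ⁅(e 0 α : GroupLieAlgebra (𝓡 m) G), (e 1 β : GroupLieAlgebra (𝓡 m) G)⁆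
      (e 2 γ)) ^ 2) / d i

/-- `g` is the `G`-invariant Riemannian metric on `G ⧸ H` determined by the inner product
`x_1 ⟨·,·⟩|_{p_1} + x_2 ⟨·,·⟩|_{p_2} + x_3 ⟨·,·⟩|_{p_3}` with `⟨·,·⟩ = -B`, where the tangent space
at the base point is identified with `p_1 ⊕ p_2 ⊕ p_3` by the differential of the projection. -/
structure IsInvariantMetric [LieGroup (𝓡 m) ∞ G] {H : Subgroup G}
    [ChartedSpace (EuclideanSpace ℝ (Fin n)) (G ⧸ H)] [IsManifold (𝓡 n) ∞ (G ⧸ H)]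
    (p : Fin 3 → Submodule ℝ (GroupLieAlgebra (𝓡 m) G)) (x : Fin 3 → ℝ)
    (g : Metric n (G ⧸ H)) : Prop where
  pos : ∀ i, 0 < x i
  invariant : ∀ (a : G) (y : G ⧸ H) (v w : TangentSpace (𝓡 n) y),
    g.inner (a • y) (mfderiv (𝓡 n) (𝓡 n) (fun q : G ⧸ H => a • q) y v)
      (mfderiv (𝓡 n) (𝓡 n) (fun q : G ⧸ H => a • q) y w) = g.inner y v w
  diagonal : ∀ i j, ∀ X ∈ p i, ∀ Y ∈ p j,
    g.inner ((1 : G) : G ⧸ H) (dproj n H X) (dproj n H Y) =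
      if i = j then x i * negKilling X Y else 0

end Homogeneous

end Wallach

end

/-!
`G` acts isometrically on `G ⧸ H`, so the Lie algebra of `G` is realized by Killing fields and the
Koszul formula computes the Levi-Civita connection and the curvature from brackets. The Ricci
curvature of the metric with parameters `x₁, x₂, x₃` is
`rᵢ = 1/2 + aᵢ (xᵢ² - xⱼ² - xₖ²) / (2 xⱼ xₖ)` in the direction of `pᵢ`. Only the sum of `Ric` over a
basis of `pᵢ` is computed: that `Ric` is diagonal and constant on each module follows from the flow
equation, because the metrics stay of this form. Along the flow `w = (xᵢ + xⱼ - xₖ) / xₖ` satisfies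
`w' = κ w + (2 (a₁ + a₂ + a₃) - 1) / xₖ` with `κ` continuous. As `a₁ + a₂ + a₃ ≥ 1/2`, the triangle
inequalities persist, and they make every `rᵢ` positive because `aᵢ ≤ 1/2`.
-/

noncomputable section

namespace Wallach

open VectorField

section Bracket

open Filter
open scoped Topology

variable {E : Type*} [NormedAddCommGroup E] [NormedSpace ℝ E]
  {H : Type*} [TopologicalSpace H] {I : ModelWithCorners ℝ E H}
  {M : Type*} [TopologicalSpace M] [ChartedSpace H M]
  {F : Type*} [NormedAddCommGroup F] [NormedSpace ℝ F]

/-- A vector field read in the chart at `x`, as a function on the model space. -/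
def chartField (x : M) (X : ∀ y : M, TangentSpace I y) : E → E :=
  mpullbackWithin 𝓘(ℝ, E) I (extChartAt I x).symm X (range I)

variable {φ : M → F} {x : M} {X Y : ∀ y : M, TangentSpace I y} [I.Boundaryless]

lemma contDiffAt_comp_extChartAt_symm {k : WithTop ℕ∞} (hφ : CMDiffAt k φ x) :
    ContDiffAt ℝ k (φ ∘ (extChartAt I x).symm) (extChartAt I x x) := by
  have h := (contMDiffAt_iff.1 hφ).2
  rwa [I.range_eq_univ, contDiffWithinAt_univ] at h

variable [IsManifold I 2 M]

lemma mvfderiv_eq_fderiv_chartField {u : E} (X : ∀ y : M, TangentSpace I y)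
    (hu : u ∈ (extChartAt I x).target) (hφ : MDiffAt φ ((extChartAt I x).symm u)) :
    d% φ ((extChartAt I x).symm u) (X ((extChartAt I x).symm u)) =
      fderiv ℝ (φ ∘ (extChartAt I x).symm) u (chartField x X u) := by
  have hsymm : MDiffAt (extChartAt I x).symm u := by
    have h := mdifferentiableWithinAt_extChartAt_symm (I := I) hu
    rwa [I.range_eq_univ, mdifferentiableWithinAt_univ] at h
  have hcancel : mfderiv 𝓘(ℝ, E) I (extChartAt I x).symm u (chartField (E := E) x X u) =
      X ((extChartAt I x).symm u) := by
    rw [← mfderivWithin_univ, ← I.range_eq_univ]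
    exact DFunLike.congr_fun
      (isInvertible_mfderivWithin_extChartAt_symm (I := I) hu).self_comp_inverse _
  rw [← hcancel, ← mfderiv_eq_fderiv]
  exact (DFunLike.congr_fun (mfderiv_comp u hφ hsymm) (chartField x X u)).symm

lemma mvfderiv_extChartAt_eq_chartField (X : ∀ y : M, TangentSpace I y) :
    d% (extChartAt I x) x (X x) = chartField x X (extChartAt I x x) := by
  have h := mvfderiv_eq_fderiv_chartField (φ := extChartAt I x) X (mem_extChartAt_target x)
    (by rw [extChartAt_to_inv]; exact mdifferentiableAt_extChartAt (mem_chart_source H x))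
  have hid : extChartAt I x ∘ (extChartAt I x).symm =ᶠ[𝓝 (extChartAt I x x)] id := by
    filter_upwards [extChartAt_target_mem_nhds (I := I) x] with u hu
    exact (extChartAt I x).right_inv hu
  rwa [extChartAt_to_inv, hid.fderiv_eq, fderiv_id] at h

lemma mvfderiv_eventuallyEq_fderiv_chartField (hφ : CMDiffAt 2 φ x)
    (X : ∀ y : M, TangentSpace I y) :
    (fun q => d% φ q (X q)) =ᶠ[𝓝 x]
      (fun u => fderiv ℝ (φ ∘ (extChartAt I x).symm) u (chartField x X u)) ∘ extChartAt I x := by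
  filter_upwards [(contMDiffAt_iff_contMDiffAt_nhds (by decide)).1 hφ,
    extChartAt_source_mem_nhds (I := I) x] with q hq hqs
  have hinv := (extChartAt I x).left_inv hqs
  have h := mvfderiv_eq_fderiv_chartField (φ := φ) X ((extChartAt I x).map_source hqs)
    (by rw [hinv]; exact hq.mdifferentiableAt (by simp))
  rwa [hinv] at h

variable [CompleteSpace E]

lemma differentiableAt_chartField (hX : MDiffAt (T% X) x) :
    DifferentiableAt ℝ (chartField x X) (extChartAt I x x) := by
  rw [← mdifferentiableWithinAt_univ] at hX
  have h := hX.differentiableWithinAt_mpullbackWithin_vectorField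
  rw [preimage_univ, univ_inter] at h
  rw [← differentiableWithinAt_univ, ← I.range_eq_univ]
  exact h

lemma hasFDerivAt_fderiv_chartField (hφ : CMDiffAt 2 φ x) (hX : MDiffAt (T% X) x) :
    HasFDerivAt (fun u => fderiv ℝ (φ ∘ (extChartAt I x).symm) u (chartField x X u))
      ((fderiv ℝ (φ ∘ (extChartAt I x).symm) (extChartAt I x x)).comp
          (fderiv ℝ (chartField x X) (extChartAt I x x)) +
        (fderiv ℝ (fderiv ℝ (φ ∘ (extChartAt I x).symm)) (extChartAt I x x)).flip
          (chartField x X (extChartAt I x x)))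
      (extChartAt I x x) :=
  (((contDiffAt_comp_extChartAt_symm hφ).fderiv_right (m := 1)
    (by norm_num)).differentiableAt (by simp)).hasFDerivAt.clm_apply
      (differentiableAt_chartField hX).hasFDerivAt

lemma hasMFDerivAt_mvfderiv (hφ : CMDiffAt 2 φ x) (hX : MDiffAt (T% X) x) :
    HasMFDerivAt I 𝓘(ℝ, F) (fun q => d% φ q (X q)) x
      (((fderiv ℝ (φ ∘ (extChartAt I x).symm) (extChartAt I x x)).comp
          (fderiv ℝ (chartField x X) (extChartAt I x x)) +
        (fderiv ℝ (fderiv ℝ (φ ∘ (extChartAt I x).symm)) (extChartAt I x x)).flip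
          (chartField x X (extChartAt I x x))).comp (mfderiv I 𝓘(ℝ, E) (extChartAt I x) x)) :=
  ((hasFDerivAt_fderiv_chartField hφ hX).hasMFDerivAt.comp x
    (mdifferentiableAt_extChartAt (mem_chart_source H x)).hasMFDerivAt).congr_of_eventuallyEq
      (mvfderiv_eventuallyEq_fderiv_chartField hφ X)

lemma mdifferentiableAt_mvfderiv (hφ : CMDiffAt 2 φ x) (hX : MDiffAt (T% X) x) :
    MDiffAt (fun q => d% φ q (X q)) x :=
  (hasMFDerivAt_mvfderiv hφ hX).mdifferentiableAt

lemma mvfderiv_mvfderiv (hφ : CMDiffAt 2 φ x) (hX : MDiffAt (T% X) x)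
    (Y : ∀ y : M, TangentSpace I y) :
    d% (fun q => d% φ q (X q)) x (Y x) =
      fderiv ℝ (φ ∘ (extChartAt I x).symm) (extChartAt I x x)
          (fderiv ℝ (chartField x X) (extChartAt I x x) (chartField x Y (extChartAt I x x))) +
        fderiv ℝ (fderiv ℝ (φ ∘ (extChartAt I x).symm)) (extChartAt I x x)
          (chartField x Y (extChartAt I x x)) (chartField x X (extChartAt I x x)) := by
  rw [← mvfderiv_extChartAt_eq_chartField Y]
  exact DFunLike.congr_fun (hasMFDerivAt_mvfderiv hφ hX).mfderiv (Y x)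

omit [CompleteSpace E] in
lemma mvfderiv_extChartAt_mlieBracket (X Y : ∀ y : M, TangentSpace I y) :
    d% (extChartAt I x) x (mlieBracket I X Y x) =
      lieBracket ℝ (chartField x X) (chartField x Y) (extChartAt I x x) := by
  rw [mlieBracket, mlieBracketWithin_apply, preimage_univ, univ_inter, ← lieBracketWithin_univ,
    ← I.range_eq_univ]
  exact DFunLike.congr_fun
    (isInvertible_mfderiv_extChartAt (mem_extChartAt_source x)).self_comp_inverse _

theorem mvfderiv_mlieBracket (hφ : CMDiffAt 2 φ x)
    (hX : MDiffAt (T% X) x) (hY : MDiffAt (T% Y) x) :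
    d% φ x (mlieBracket I X Y x) =
      d% (fun q => d% φ q (Y q)) x (X x) - d% (fun q => d% φ q (X q)) x (Y x) := by
  have hchart : d% φ x (mlieBracket I X Y x) =
      fderiv ℝ (φ ∘ (extChartAt I x).symm) (extChartAt I x x)
        (lieBracket ℝ (chartField x X) (chartField x Y) (extChartAt I x x)) := by
    have h := mvfderiv_eq_fderiv_chartField (φ := φ) (mlieBracket I X Y) (mem_extChartAt_target x)
      (by rw [extChartAt_to_inv]; exact hφ.mdifferentiableAt (by simp))
    rwa [extChartAt_to_inv, ← mvfderiv_extChartAt_eq_chartField,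
      mvfderiv_extChartAt_mlieBracket] at h
  have hsymm := (contDiffAt_comp_extChartAt_symm hφ).isSymmSndFDerivAt (by simp)
  rw [hchart, mvfderiv_mvfderiv hφ hY, mvfderiv_mvfderiv hφ hX, hsymm, lieBracket, map_sub]
  abel

end Bracket

section IsRelated

open Filter
open scoped Topology

variable {E : Type*} [NormedAddCommGroup E] [NormedSpace ℝ E]
  {H : Type*} [TopologicalSpace H] {I : ModelWithCorners ℝ E H}
  {M : Type*} [TopologicalSpace M] [ChartedSpace H M]
  {E' : Type*} [NormedAddCommGroup E'] [NormedSpace ℝ E']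
  {H' : Type*} [TopologicalSpace H'] {I' : ModelWithCorners ℝ E' H'}
  {M' : Type*} [TopologicalSpace M'] [ChartedSpace H' M']
  {F : Type*} [NormedAddCommGroup F] [NormedSpace ℝ F]

/-- The vector fields `X` and `X'` are `f`-related: `df (X q) = X' (f q)` for all `q`. -/
def IsRelated (f : M → M') (X : ∀ q : M, TangentSpace I q) (X' : ∀ q : M', TangentSpace I' q) :
    Prop :=
  ∀ q, mfderiv I I' f q (X q) = X' (f q)

namespace IsRelated

variable {f : M → M'} {φ : M' → F} {x : M}
  {X Y : ∀ q : M, TangentSpace I q} {X' Y' : ∀ q : M', TangentSpace I' q}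

lemma mvfderiv_comp (hX : IsRelated f X X') (hφ : MDiffAt φ (f x)) (hf : MDiffAt f x) :
    d% (φ ∘ f) x (X x) = d% φ (f x) (X' (f x)) := by
  rw [← hX x]
  exact DFunLike.congr_fun (mfderiv_comp x hφ hf) (X x)

variable [I'.Boundaryless] [IsManifold I' 2 M'] [CompleteSpace E']

lemma mvfderiv_mvfderiv_comp (hX : IsRelated f X X') (hY : IsRelated f Y Y')
    (hf : CMDiff 2 f) (hφ : CMDiffAt 2 φ (f x)) (hX' : MDiffAt (T% X') (f x)) :
    d% (fun q => d% (φ ∘ f) q (X q)) x (Y x) =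
      d% (fun q => d% φ q (X' q)) (f x) (Y' (f x)) := by
  have hfd : MDiff f := hf.mdifferentiable (by simp)
  have hcomp : (fun q => d% (φ ∘ f) q (X q)) =ᶠ[𝓝 x] (fun q => d% φ q (X' q)) ∘ f := by
    filter_upwards [(hf.continuous.tendsto x).eventually
      ((contMDiffAt_iff_contMDiffAt_nhds (by decide)).1 hφ)] with q hq
    exact hX.mvfderiv_comp (hq.mdifferentiableAt (by simp)) (hfd q)
  rw [mvfderiv, hcomp.mfderiv_eq]
  exact hY.mvfderiv_comp (mdifferentiableAt_mvfderiv hφ hX') (hfd x)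

variable [I.Boundaryless] [IsManifold I 2 M] [CompleteSpace E]

theorem mfderiv_mlieBracket (hXX' : IsRelated f X X') (hYY' : IsRelated f Y Y')
    (hf : CMDiff 2 f) (hX : MDiffAt (T% X) x) (hY : MDiffAt (T% Y) x)
    (hX' : MDiffAt (T% X') (f x)) (hY' : MDiffAt (T% Y') (f x)) :
    mfderiv I I' f x (mlieBracket I X Y x) = mlieBracket I' X' Y' (f x) := by
  have hchart : CMDiffAt 2 (extChartAt I' (f x)) (f x) := contMDiffAt_extChartAt
  apply (isInvertible_mfderiv_extChartAt (I := I') (mem_extChartAt_source (f x))).injective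
  calc d% (extChartAt I' (f x)) (f x) (mfderiv I I' f x (mlieBracket I X Y x))
      = d% (extChartAt I' (f x) ∘ f) x (mlieBracket I X Y x) :=
        (DFunLike.congr_fun (mfderiv_comp x (hchart.mdifferentiableAt (by simp))
          (hf.mdifferentiable (by simp) x)) _).symm
    _ = d% (extChartAt I' (f x)) (f x) (mlieBracket I' X' Y' (f x)) := by
        rw [mvfderiv_mlieBracket (hchart.comp x hf.contMDiffAt) hX hY,
          hYY'.mvfderiv_mvfderiv_comp hXX' hf hchart hY',
          hXX'.mvfderiv_mvfderiv_comp hYY' hf hchart hX', mvfderiv_mlieBracket hchart hX' hY']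

end IsRelated

end IsRelated

section Derivative

variable {E : Type*} [NormedAddCommGroup E] [NormedSpace ℝ E]
  {H : Type*} [TopologicalSpace H] {I : ModelWithCorners ℝ E H}
  {M : Type*} [TopologicalSpace M] [ChartedSpace H M]
  {E' : Type*} [NormedAddCommGroup E'] [NormedSpace ℝ E']
  {H' : Type*} [TopologicalSpace H'] {I' : ModelWithCorners ℝ E' H'}
  {M' : Type*} [TopologicalSpace M'] [ChartedSpace H' M']
  {E'' : Type*} [NormedAddCommGroup E''] [NormedSpace ℝ E'']
  {H'' : Type*} [TopologicalSpace H''] {I'' : ModelWithCorners ℝ E'' H''}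
  {M'' : Type*} [TopologicalSpace M''] [ChartedSpace H'' M'']

variable (I I') in
/-- The derivative of a map between manifolds, as a linear map between the model spaces. Tangent
spaces at different points that are only propositionally equal are thus identified. -/
def mderiv (f : M → M') (x : M) : E →L[ℝ] E' := mfderiv I I' f x

lemma mderiv_comp {g : M' → M''} {f : M → M'} (x : M) (hg : MDiffAt g (f x)) (hf : MDiffAt f x)
    (v : E) :
    mderiv I I'' (fun y => g (f y)) x v = mderiv I' I'' g (f x) (mderiv I I' f x v) :=
  DFunLike.congr_fun (mfderiv_comp x hg hf) v

lemma mderiv_id (x : M) (v : E) : mderiv I I (fun y : M => y) x v = v :=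
  DFunLike.congr_fun (mfderiv_id (I := I) (x := x)) v

lemma mderiv_prod {f : M × M' → M''} {p : M × M'} (hf : MDiffAt f p) (v : E × E') :
    mderiv (I.prod I') I'' f p v =
      mderiv I I'' (fun z => f (z, p.2)) p.1 v.1 + mderiv I' I'' (fun z => f (p.1, z)) p.2 v.2 :=
  mfderiv_prod_eq_add_apply hf

end Derivative

section BracketCalculus

variable {E : Type*} [NormedAddCommGroup E] [NormedSpace ℝ E] [CompleteSpace E]
  {H : Type*} [TopologicalSpace H] {I : ModelWithCorners ℝ E H}
  {M : Type*} [TopologicalSpace M] [ChartedSpace H M] [IsManifold I 2 M]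

lemma mlieBracket_sum_smul_right {ι : Type*} (s : Finset ι) {f : ι → M → ℝ}
    {W : ι → ∀ y : M, TangentSpace I y} {x : M} (V : ∀ y : M, TangentSpace I y)
    (hf : ∀ i, MDiffAt (f i) x) (hW : ∀ i, MDiffAt (T% (W i)) x) :
    mlieBracket I V (∑ i ∈ s, f i • W i) x =
      ∑ i ∈ s, (d% (f i) x (V x) • W i x + f i x • mlieBracket I V (W i) x) := by
  classical
  have hfW : ∀ i, MDiffAt (T% (f i • W i)) x := fun i => (hf i).smul_section (hW i)
  have hsum : ∀ s : Finset ι, MDiffAt (T% (∑ i ∈ s, f i • W i)) x := by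
    intro s
    induction s using Finset.induction_on with
    | empty => exact mdifferentiableAt_zeroSection ℝ _
    | insert i s hi ih => rw [Finset.sum_insert hi]; exact mdifferentiableAt_add_section (hfW i) ih
  induction s using Finset.induction_on with
  | empty => simp only [Finset.sum_empty, mlieBracket_zero_right, Pi.zero_apply]
  | insert i s hi ih =>
    rw [Finset.sum_insert hi, Finset.sum_insert hi, mlieBracket_add_right (hfW i) (hsum s), ih,
      mlieBracket_smul_right (hf i) (hW i)]

variable {E' : Type*} [NormedAddCommGroup E'] [NormedSpace ℝ E'] [CompleteSpace E']
  {H' : Type*} [TopologicalSpace H'] {I' : ModelWithCorners ℝ E' H'}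
  {M' : Type*} [TopologicalSpace M'] [ChartedSpace H' M'] [IsManifold I' 2 M']

/-- The vector field `X ⊕ X'` on the product of two manifolds. -/
def prodField (X : ∀ q : M, TangentSpace I q) (X' : ∀ q : M', TangentSpace I' q) (p : M × M') :
    TangentSpace (I.prod I') p :=
  (X p.1, X' p.2)

omit [CompleteSpace E] [CompleteSpace E'] in
lemma mdifferentiableAt_prodField {X : ∀ q : M, TangentSpace I q}
    {X' : ∀ q : M', TangentSpace I' q} {p : M × M'} (hX : MDiffAt (T% X) p.1)
    (hX' : MDiffAt (T% X') p.2) : MDiffAt (T% (prodField X X')) p :=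
  ((contMDiff_equivTangentBundleProd_symm (n := 1)).mdifferentiable (by simp) _).comp p
    ((hX.comp p mdifferentiableAt_fst).prodMk (hX'.comp p mdifferentiableAt_snd))

omit [CompleteSpace E] [CompleteSpace E'] [IsManifold I 2 M] [IsManifold I' 2 M'] in
lemma isRelated_fst (X : ∀ q : M, TangentSpace I q) (X' : ∀ q : M', TangentSpace I' q) :
    IsRelated Prod.fst (prodField X X') X := fun p =>
  DFunLike.congr_fun (mfderiv_fst (x := p)) (prodField X X' p)

omit [CompleteSpace E] [CompleteSpace E'] [IsManifold I 2 M] [IsManifold I' 2 M'] in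
lemma isRelated_snd (X : ∀ q : M, TangentSpace I q) (X' : ∀ q : M', TangentSpace I' q) :
    IsRelated Prod.snd (prodField X X') X' := fun p =>
  DFunLike.congr_fun (mfderiv_snd (x := p)) (prodField X X' p)

lemma mlieBracket_prodField [I.Boundaryless] [I'.Boundaryless]
    {X Y : ∀ q : M, TangentSpace I q} {X' Y' : ∀ q : M', TangentSpace I' q} {p : M × M'}
    (hX : MDiffAt (T% X) p.1) (hY : MDiffAt (T% Y) p.1)
    (hX' : MDiffAt (T% X') p.2) (hY' : MDiffAt (T% Y') p.2) :
    mlieBracket (I.prod I') (prodField X X') (prodField Y Y') p =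
      prodField (mlieBracket I X Y) (mlieBracket I' X' Y') p := by
  have hXX' := mdifferentiableAt_prodField hX hX'
  have hYY' := mdifferentiableAt_prodField hY hY'
  have hfst := (isRelated_fst X X').mfderiv_mlieBracket (isRelated_fst Y Y') contMDiff_fst
    hXX' hYY' hX hY
  have hsnd := (isRelated_snd X X').mfderiv_mlieBracket (isRelated_snd Y Y') contMDiff_snd
    hXX' hYY' hX' hY'
  rw [mfderiv_fst] at hfst
  rw [mfderiv_snd] at hsnd
  exact Prod.ext hfst hsnd

end BracketCalculus

section Action

variable {m n : ℕ} {G : Type*} [TopologicalSpace G] [ChartedSpace (EuclideanSpace ℝ (Fin m)) G]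
  [Group G] {M : Type*} [TopologicalSpace M] [ChartedSpace (EuclideanSpace ℝ (Fin n)) M]

/-- `act` is a smooth left action of `G` on `M`. The action is a plain function because several
actions of the same group on the same space are used. -/
structure IsSmoothAction (m n : ℕ) {G : Type*} [TopologicalSpace G]
    [ChartedSpace (EuclideanSpace ℝ (Fin m)) G] [Group G] {M : Type*} [TopologicalSpace M]
    [ChartedSpace (EuclideanSpace ℝ (Fin n)) M] (act : G → M → M) : Prop where
  contMDiff : ContMDiff ((𝓡 m).prod (𝓡 n)) (𝓡 n) ∞ (fun q : G × M => act q.1 q.2)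
  mul : ∀ a b y, act (a * b) y = act a (act b y)
  one : ∀ y, act 1 y = y

/-- The vector field on `M` generated by an element of the Lie algebra of `G`. -/
def fundField (act : G → M → M) (X : GroupLieAlgebra (𝓡 m) G) (y : M) : TangentSpace (𝓡 n) y :=
  mderiv (𝓡 m) (𝓡 n) (fun b : G => act b y) 1 X

lemma fundField_add (act : G → M → M) (X Y : GroupLieAlgebra (𝓡 m) G) (y : M) :
    (fundField act (X + Y) y : TangentSpace (𝓡 n) y) = fundField act X y + fundField act Y y :=
  map_add (mderiv (𝓡 m) (𝓡 n) (fun b : G => act b y) 1) X Y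

lemma fundField_smul (act : G → M → M) (c : ℝ) (X : GroupLieAlgebra (𝓡 m) G) (y : M) :
    (fundField act (c • X) y : TangentSpace (𝓡 n) y) = c • fundField act X y :=
  map_smul (mderiv (𝓡 m) (𝓡 n) (fun b : G => act b y) 1) c X

lemma fundField_neg (act : G → M → M) (X : GroupLieAlgebra (𝓡 m) G) (y : M) :
    (fundField act (-X) y : TangentSpace (𝓡 n) y) = -fundField act X y :=
  map_neg (mderiv (𝓡 m) (𝓡 n) (fun b : G => act b y) 1) X

/-- The right invariant vector field on a Lie group: it generates the left translations. -/
abbrev rightField (X : GroupLieAlgebra (𝓡 m) G) (a : G) : TangentSpace (𝓡 m) a :=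
  fundField (n := m) (fun b c : G => b * c) X a

lemma rightField_one (X : GroupLieAlgebra (𝓡 m) G) : rightField X 1 = X := by
  simp only [rightField, fundField, mul_one]
  exact mderiv_id (I := 𝓡 m) (1 : G) (X : EuclideanSpace ℝ (Fin m))

lemma mulInvariantVectorField_one (X : GroupLieAlgebra (𝓡 m) G) :
    mulInvariantVectorField X (1 : G) = X := by
  have hmul : (fun a : G => 1 * a) = fun a => a := by funext a; exact one_mul a
  simp only [mulInvariantVectorField]
  rw [hmul]
  exact mderiv_id (I := 𝓡 m) (1 : G) (X : EuclideanSpace ℝ (Fin m))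

/-- `a ↦ Ad(a⁻¹) Y`, as a function with values in the model space. -/
def adInv (Y : GroupLieAlgebra (𝓡 m) G) (a : G) : EuclideanSpace ℝ (Fin m) :=
  mderiv (𝓡 m) (𝓡 m) (fun b : G => a⁻¹ * b * a) 1 Y

lemma adInv_one (Y : GroupLieAlgebra (𝓡 m) G) : adInv Y (1 : G) = Y := by
  simp only [adInv, inv_one, one_mul, mul_one]
  exact mderiv_id (I := 𝓡 m) (1 : G) (Y : EuclideanSpace ℝ (Fin m))

variable [LieGroup (𝓡 m) ∞ G]

lemma mdifferentiable_mul_left (a : G) : MDifferentiable (𝓡 m) (𝓡 m) (fun b : G => a * b) :=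
  (contMDiff_mul_left (n := ∞)).mdifferentiable (by simp)

lemma mdifferentiable_mul_right (a : G) : MDifferentiable (𝓡 m) (𝓡 m) (fun b : G => b * a) :=
  (contMDiff_mul_right (n := ∞)).mdifferentiable (by simp)

lemma mdifferentiable_conj_inv (a : G) :
    MDifferentiable (𝓡 m) (𝓡 m) (fun b : G => a⁻¹ * b * a) :=
  (mdifferentiable_mul_right a).comp (mdifferentiable_mul_left a⁻¹)

lemma isSmoothAction_mul (m : ℕ) (G : Type*) [TopologicalSpace G]
    [ChartedSpace (EuclideanSpace ℝ (Fin m)) G] [Group G] [LieGroup (𝓡 m) ∞ G] :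
    IsSmoothAction m m (fun a b : G => a * b) where
  contMDiff := contMDiff_mul (𝓡 m) ∞
  mul := mul_assoc
  one := one_mul

namespace IsSmoothAction

variable {act : G → M → M} (h : IsSmoothAction m n act)
include h

omit [LieGroup (𝓡 m) ∞ G] in
lemma contMDiff_left (y : M) : ContMDiff (𝓡 m) (𝓡 n) ∞ (fun a => act a y) :=
  h.contMDiff.comp (contMDiff_id.prodMk contMDiff_const)

omit [LieGroup (𝓡 m) ∞ G] in
lemma contMDiff_right (a : G) : ContMDiff (𝓡 n) (𝓡 n) ∞ (act a) :=
  h.contMDiff.comp (contMDiff_const.prodMk contMDiff_id)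

lemma isRelated_rightField (X : GroupLieAlgebra (𝓡 m) G) (y : M) :
    IsRelated (fun b => act b y) (rightField X) (fundField act X : ∀ y, TangentSpace (𝓡 n) y) := by
  intro a
  have hchain := mderiv_comp (I' := 𝓡 m) (1 : G) ((h.contMDiff_left y).mdifferentiable (by simp) _)
    (mdifferentiable_mul_right a _) X
  simp only [one_mul, h.mul] at hchain
  exact hchain.symm

lemma mderiv_fundField_adInv (X : GroupLieAlgebra (𝓡 m) G) (a : G) (y : M) :
    mderiv (𝓡 n) (𝓡 n) (act a) y (fundField act (adInv X a) y) =
      (fundField act X (act a y) : TangentSpace (𝓡 n) (act a y)) := by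
  have horbit : MDifferentiable (𝓡 m) (𝓡 n) (fun b => act b y) :=
    (h.contMDiff_left y).mdifferentiable (by simp)
  have hconj : MDifferentiable (𝓡 m) (𝓡 n) (fun b => act (a⁻¹ * b * a) y) :=
    horbit.comp (mdifferentiable_conj_inv a)
  have hact := (h.contMDiff_right a).mdifferentiable (by simp)
  have hin := mderiv_comp (I' := 𝓡 m) (1 : G) (horbit _) (mdifferentiable_conj_inv a 1) X
  have hout := mderiv_comp (I' := 𝓡 n) (1 : G) (hact _) (hconj 1) X
  have hinv : ∀ b, act a (act (a⁻¹ * b * a) y) = act b (act a y) := fun b => by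
    rw [← h.mul, ← h.mul]; group
  simp only [mul_one, inv_mul_cancel] at hin
  simp only [hinv, mul_one, inv_mul_cancel, h.one, hin] at hout
  exact hout.symm

variable [IsManifold (𝓡 n) ∞ M]

theorem isSmoothField_fundField (X : GroupLieAlgebra (𝓡 m) G) :
    IsSmoothField (fundField act X : ∀ y : M, TangentSpace (𝓡 n) y) := by
  have hzero : ContMDiff (𝓡 n) ((𝓡 n).prod (𝓡 n)) ∞
      (fun y : M => (⟨y, 0⟩ : TangentBundle (𝓡 n) M)) := contMDiff_zeroSection _ _
  have hconst : ContMDiff (𝓡 n) ((𝓡 m).prod (𝓡 m)) ∞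
      (fun _ : M => (⟨1, X⟩ : TangentBundle (𝓡 m) G)) := contMDiff_const
  have htangent := ((h.contMDiff.contMDiff_tangentMap (m := ∞) le_rfl).comp
    contMDiff_equivTangentBundleProd_symm).comp (hconst.prodMk hzero)
  unfold IsSmoothField
  convert! htangent with y
  · exact (h.one y).symm
  · have hprod := mderiv_prod (h.contMDiff.mdifferentiable (by simp) ((1 : G), y))
      (X, (0 : EuclideanSpace ℝ (Fin n)))
    rw [map_zero, add_zero] at hprod
    exact hprod.symm

lemma mdifferentiableAt_fundField (X : GroupLieAlgebra (𝓡 m) G) (y : M) :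
    MDifferentiableAt (𝓡 n) (𝓡 n).tangent
      (fun y => (⟨y, fundField act X y⟩ : TangentBundle (𝓡 n) M)) y :=
  (h.isSmoothField_fundField X).mdifferentiable (by simp) y

end IsSmoothAction

lemma isRelated_mul_mulInvariantVectorField (Y : GroupLieAlgebra (𝓡 m) G) :
    IsRelated (fun p : G × G => p.1 * p.2)
      (prodField (0 : ∀ a : G, TangentSpace (𝓡 m) a) (mulInvariantVectorField Y))
      (mulInvariantVectorField Y) := by
  intro p
  have hprod := mderiv_prod ((contMDiff_mul (𝓡 m) ∞).mdifferentiable (by simp) p)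
    ((0 : EuclideanSpace ℝ (Fin m)), mulInvariantVectorField Y p.2)
  have hchain := mderiv_comp (I' := 𝓡 m) (1 : G) (mdifferentiable_mul_left p.1 _)
    (mdifferentiable_mul_left p.2 1) Y
  simp only [mul_one, ← mul_assoc] at hchain
  rw [map_zero, zero_add] at hprod
  exact hprod.trans hchain.symm

lemma isRelated_mul_rightField (X : GroupLieAlgebra (𝓡 m) G) :
    IsRelated (fun p : G × G => p.1 * p.2)
      (prodField (rightField X) (0 : ∀ a : G, TangentSpace (𝓡 m) a)) (rightField X) := by
  intro p
  have hprod := mderiv_prod ((contMDiff_mul (𝓡 m) ∞).mdifferentiable (by simp) p)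
    (rightField X p.1, (0 : EuclideanSpace ℝ (Fin m)))
  rw [map_zero, add_zero] at hprod
  exact hprod.trans ((isSmoothAction_mul m G).isRelated_rightField X p.2 p.1)

-- `rightField X ⊕ 0` and `0 ⊕ mulInvariantVectorField Y` commute on `G × G`, and multiplication
-- relates them to the two fields.
theorem mlieBracket_rightField_mulInvariantVectorField (X Y : GroupLieAlgebra (𝓡 m) G) (a : G) :
    mlieBracket (𝓡 m) (rightField X) (mulInvariantVectorField Y) a = 0 := by
  have hR := (isSmoothAction_mul m G).mdifferentiableAt_fundField X
  have hL : ∀ b : G, MDifferentiableAt (𝓡 m) (𝓡 m).tangent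
      (fun c => (⟨c, mulInvariantVectorField Y c⟩ : TangentBundle (𝓡 m) G)) b :=
    fun b => mdifferentiableAt_mulInvariantVectorField Y
  have h0 : ∀ b : G, MDifferentiableAt (𝓡 m) (𝓡 m).tangent
      (fun c => (⟨c, (0 : ∀ c : G, TangentSpace (𝓡 m) c) c⟩ : TangentBundle (𝓡 m) G)) b :=
    fun b => mdifferentiableAt_zeroSection ℝ _
  have hbracket := (isRelated_mul_rightField X).mfderiv_mlieBracket
    (isRelated_mul_mulInvariantVectorField Y) (x := (a, 1))
    ((contMDiff_mul (𝓡 m) ∞).of_le ENat.LEInfty.out)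
    (mdifferentiableAt_prodField (hR a) (h0 1)) (mdifferentiableAt_prodField (h0 a) (hL 1))
    (hR _) (hL _)
  rw [mlieBracket_prodField (hR a) (h0 a) (h0 1) (hL 1), mlieBracket_zero_left,
    mlieBracket_zero_right, mul_one] at hbracket
  exact hbracket.symm.trans (map_zero (mderiv ((𝓡 m).prod (𝓡 m)) (𝓡 m) _ (a, (1 : G))))

lemma mdifferentiableAt_adInv (Y : GroupLieAlgebra (𝓡 m) G) :
    MDifferentiableAt (𝓡 m) (𝓡 m) (adInv Y) (1 : G) := by
  have hconj : ContMDiff ((𝓡 m).prod (𝓡 m)) (𝓡 m) ∞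
      (Function.uncurry fun a b : G => a⁻¹ * b * a) :=
    (contMDiff_fst.inv.mul contMDiff_snd).mul contMDiff_fst
  have hcoord := ContMDiffAt.mfderiv (m := 1) (x₀ := (1 : G)) (fun a b : G => a⁻¹ * b * a)
    (fun _ => (1 : G)) hconj.contMDiffAt contMDiffAt_const
    (by rw [one_add_one_eq_two]; exact ENat.LEInfty.out)
  have hfixed : (fun a : G => a⁻¹ * 1 * a) = fun _ => 1 := by funext a; group
  have htangent : inTangentCoordinates (𝓡 m) (𝓡 m) (fun _ : G => (1 : G))
      (fun a : G => a⁻¹ * 1 * a) (fun a => mderiv (𝓡 m) (𝓡 m) (fun b : G => a⁻¹ * b * a) 1) 1 =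
      fun a => mderiv (𝓡 m) (𝓡 m) (fun b : G => a⁻¹ * b * a) 1 := by
    rw [hfixed]
    ext a v : 2
    rw [inTangentCoordinates_eq (fun _ : G => (1 : G)) (fun _ : G => (1 : G)) _
      (mem_chart_source _ _) (mem_chart_source _ _)]
    simp only [ContinuousLinearMap.comp_apply]
    rw [(tangentBundleCore (𝓡 m) G).coordChange_self _ _ (mem_chart_source _ _),
      (tangentBundleCore (𝓡 m) G).coordChange_self _ _ (mem_chart_source _ _)]
  have hsmooth : ContMDiffAt (𝓡 m) 𝓘(ℝ, EuclideanSpace ℝ (Fin m) →L[ℝ] EuclideanSpace ℝ (Fin m)) 1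
    (fun a : G => mderiv (𝓡 m) (𝓡 m) (fun b : G => a⁻¹ * b * a) 1) 1 := htangent ▸ hcoord
  exact (hsmooth.mdifferentiableAt (by simp)).clm_apply mdifferentiableAt_const

lemma mulInvariantVectorField_adInv (Y : GroupLieAlgebra (𝓡 m) G) (a : G) :
    mulInvariantVectorField (adInv Y a : GroupLieAlgebra (𝓡 m) G) a = rightField Y a := by
  have hchain := mderiv_comp (I' := 𝓡 m) (1 : G) (mdifferentiable_mul_left a _)
    (mdifferentiable_conj_inv a 1) Y
  have hconj : ∀ b, a * (a⁻¹ * b * a) = b * a := fun b => by group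
  simp only [hconj, mul_one, inv_mul_cancel] at hchain
  exact hchain.symm

end Action

section AdjointDerivative

variable {m n : ℕ} {G : Type*} [TopologicalSpace G] [ChartedSpace (EuclideanSpace ℝ (Fin m)) G]
  [Group G] {M : Type*} [TopologicalSpace M] [ChartedSpace (EuclideanSpace ℝ (Fin n)) M]

/-- The derivative at `1`, in the direction `X`, of `a ↦ Ad(a⁻¹) Y`, as an element of the Lie
algebra; it turns out to be `-⁅X, Y⁆`. -/
def adInvDeriv (X Y : GroupLieAlgebra (𝓡 m) G) : GroupLieAlgebra (𝓡 m) G :=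
  mvfderiv (𝓡 m) (adInv Y) 1 X

lemma mulInvariantVectorField_eq_sum (X : EuclideanSpace ℝ (Fin m)) (a : G) :
    mulInvariantVectorField (I := 𝓡 m) (X : GroupLieAlgebra (𝓡 m) G) a = ∑ i, X i •
      mulInvariantVectorField (I := 𝓡 m) (G := G) (EuclideanSpace.basisFun (Fin m) ℝ i) a := by
  have hsum := congrArg (mderiv (𝓡 m) (𝓡 m) (fun b : G => a * b) 1)
    ((EuclideanSpace.basisFun (Fin m) ℝ).sum_repr X)
  simp only [map_sum, map_smul, EuclideanSpace.basisFun_repr] at hsum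
  exact hsum.symm

variable [LieGroup (𝓡 m) ∞ G]

lemma rightField_eq_sum (Y : GroupLieAlgebra (𝓡 m) G) :
    rightField Y = ∑ i, (fun a => adInv Y a i) • (fun a : G =>
      mulInvariantVectorField (I := 𝓡 m) (EuclideanSpace.basisFun (Fin m) ℝ i) a) := by
  funext a
  rw [Finset.sum_apply]
  exact (mulInvariantVectorField_adInv Y a).symm.trans (mulInvariantVectorField_eq_sum _ a)

lemma mlieBracket_rightField_eq_sum (V : ∀ a : G, TangentSpace (𝓡 m) a)
    (Y : GroupLieAlgebra (𝓡 m) G) :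
    mlieBracket (𝓡 m) V (rightField Y) (1 : G) =
      adInvDeriv (V 1) Y + ∑ i, adInv Y (1 : G) i • mlieBracket (𝓡 m) V
        (mulInvariantVectorField (EuclideanSpace.basisFun (Fin m) ℝ i)) 1 := by
  have hcoord : ∀ i, HasMFDerivAt (𝓡 m) 𝓘(ℝ, ℝ) (fun a : G => adInv Y a i) 1
      ((EuclideanSpace.proj i : EuclideanSpace ℝ (Fin m) →L[ℝ] ℝ).comp
        (mvfderiv (𝓡 m) (adInv Y) 1)) := fun i =>
    (EuclideanSpace.proj i : EuclideanSpace ℝ (Fin m) →L[ℝ] ℝ).hasFDerivAt.hasMFDerivAt.comp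
      (1 : G) (mdifferentiableAt_adInv Y).hasMFDerivAt
  have hleibniz := mlieBracket_sum_smul_right Finset.univ (x := (1 : G)) V
    (fun i => (hcoord i).mdifferentiableAt)
    (fun i => mdifferentiableAt_mulInvariantVectorField (EuclideanSpace.basisFun (Fin m) ℝ i))
  have hderiv : ∀ i, mvfderiv (𝓡 m) (fun a : G => adInv Y a i) 1 (V 1) =
      (mvfderiv (𝓡 m) (adInv Y) 1 (V 1) : EuclideanSpace ℝ (Fin m)) i := fun i =>
    DFunLike.congr_fun (hcoord i).mfderiv (V 1)
  rw [rightField_eq_sum Y]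
  refine hleibniz.trans ?_
  simp only [hderiv, Finset.sum_add_distrib]
  congr 1
  refine (Finset.sum_congr rfl fun i _ =>
    congrArg (_ • ·) (mulInvariantVectorField_one (m := m) (G := G) _)).trans ?_
  exact (EuclideanSpace.basisFun (Fin m) ℝ).sum_repr (mvfderiv (𝓡 m) (adInv Y) 1 (V 1))

theorem adInvDeriv_eq_neg_lie (X Y : GroupLieAlgebra (𝓡 m) G) : adInvDeriv X Y = -⁅X, Y⁆ := by
  have hzero : mlieBracket (𝓡 m) (mulInvariantVectorField X) (rightField Y) (1 : G) = 0 := by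
    rw [mlieBracket_swap_apply, mlieBracket_rightField_mulInvariantVectorField, neg_zero]
  rw [mlieBracket_rightField_eq_sum, mulInvariantVectorField_one] at hzero
  have hbracket : ∑ i, adInv Y (1 : G) i • mlieBracket (𝓡 m)
      (mulInvariantVectorField X)
      (mulInvariantVectorField (EuclideanSpace.basisFun (Fin m) ℝ i)) (1 : G) = ⁅X, Y⁆ := by
    have hsum := congrArg (LieAlgebra.ad ℝ (GroupLieAlgebra (𝓡 m) G) X)
      ((EuclideanSpace.basisFun (Fin m) ℝ).sum_repr (adInv Y (1 : G)))
    simp only [EuclideanSpace.basisFun_repr] at hsum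
    refine Eq.trans ?_ (hsum.trans (congrArg _ (adInv_one Y)))
    exact (map_sum (LieAlgebra.ad ℝ (GroupLieAlgebra (𝓡 m) G) X) _ _).symm ▸
      Finset.sum_congr rfl fun i _ =>
        (map_smul (LieAlgebra.ad ℝ (GroupLieAlgebra (𝓡 m) G) X) _ _).symm
  rw [hbracket] at hzero
  exact eq_neg_of_add_eq_zero_left hzero

lemma mlieBracket_rightField_one (X Y : GroupLieAlgebra (𝓡 m) G) :
    mlieBracket (𝓡 m) (rightField X) (rightField Y) (1 : G) = -⁅X, Y⁆ := by
  rw [mlieBracket_rightField_eq_sum, rightField_one, adInvDeriv_eq_neg_lie]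
  refine (congrArg (_ + ·) (Finset.sum_eq_zero fun i _ => ?_)).trans (add_zero _)
  exact (congrArg (_ • ·) (mlieBracket_rightField_mulInvariantVectorField X _ 1)).trans
    (smul_zero _)

theorem IsSmoothAction.mlieBracket_fundField [IsManifold (𝓡 n) ∞ M] {act : G → M → M}
    (h : IsSmoothAction m n act) (X Y : GroupLieAlgebra (𝓡 m) G) (y : M) :
    mlieBracket (𝓡 n) (fundField act X) (fundField act Y) y = -fundField act ⁅X, Y⁆ y := by
  have hmul := isSmoothAction_mul m G
  have hbracket := (h.isRelated_rightField X y).mfderiv_mlieBracket (h.isRelated_rightField Y y)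
    (x := 1) ((h.contMDiff_left y).of_le ENat.LEInfty.out)
    (hmul.mdifferentiableAt_fundField X _) (hmul.mdifferentiableAt_fundField Y _)
    (h.mdifferentiableAt_fundField X _) (h.mdifferentiableAt_fundField Y _)
  rw [mlieBracket_rightField_one, h.one] at hbracket
  exact hbracket.symm.trans (fundField_neg act ⁅X, Y⁆ y)

end AdjointDerivative

section KillingFields

variable {n : ℕ} {M : Type*} [TopologicalSpace M] [ChartedSpace (EuclideanSpace ℝ (Fin n)) M]
  [IsManifold (𝓡 n) ∞ M]

lemma contMDiff_inner (g : Metric n M) {Y Z : ∀ y : M, TangentSpace (𝓡 n) y}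
    (hY : IsSmoothField Y) (hZ : IsSmoothField Z) :
    ContMDiff (𝓡 n) 𝓘(ℝ, ℝ) ∞ (fun q => g.inner q (Y q) (Z q)) := by
  intro x
  have hsection : ContMDiffAt (𝓡 n) ((𝓡 n).prod 𝓘(ℝ)) ∞
      (fun q => TotalSpace.mk' ℝ (E := Bundle.Trivial M ℝ) q (g.inner q (Y q) (Z q))) x :=
    ContMDiffAt.clm_bundle_apply₂ (F₁ := EuclideanSpace ℝ (Fin n))
      (F₂ := EuclideanSpace ℝ (Fin n)) (g.contMDiff x) (hY x) (hZ x)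
  rw [contMDiffAt_totalSpace] at hsection
  exact hsection.2

/-- A family of Killing fields, parametrized linearly by a Lie algebra, on which the bracket of
vector fields is the opposite of the bracket of the Lie algebra, as for the generators of a left
action. -/
structure IsKillingFamily {L : Type*} [LieRing L] [LieAlgebra ℝ L] (g : Metric n M)
    (K : L → ∀ y : M, TangentSpace (𝓡 n) y) : Prop where
  add : ∀ X Y y, K (X + Y) y = K X y + K Y y
  smul : ∀ (c : ℝ) X y, K (c • X) y = c • K X y
  smooth : ∀ X, IsSmoothField (K X)
  bracket : ∀ X Y y, mlieBracket (𝓡 n) (K X) (K Y) y = -K ⁅X, Y⁆ y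
  killing : ∀ X Y Z y,
    mvfderiv (𝓡 n) (fun q => g.inner q (K Y q) (K Z q)) y (K X y) =
      -g.inner y (K ⁅X, Y⁆ y) (K Z y) - g.inner y (K Y y) (K ⁅X, Z⁆ y)

variable {m : ℕ} {G : Type*} [TopologicalSpace G] [ChartedSpace (EuclideanSpace ℝ (Fin m)) G]
  [Group G] [LieGroup (𝓡 m) ∞ G]

lemma mvfderiv_bilinear_adInv
    (Q : EuclideanSpace ℝ (Fin m) →L[ℝ] EuclideanSpace ℝ (Fin m) →L[ℝ] ℝ)
    (X Y Z : GroupLieAlgebra (𝓡 m) G) :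
    mvfderiv (𝓡 m) (fun a : G => Q (adInv Y a) (adInv Z a)) 1 X =
      -Q (⁅X, Y⁆ : GroupLieAlgebra (𝓡 m) G) Z - Q Y (⁅X, Z⁆ : GroupLieAlgebra (𝓡 m) G) := by
  have hY := (mdifferentiableAt_adInv (G := G) Y).hasMFDerivAt
  have hZ := (mdifferentiableAt_adInv (G := G) Z).hasMFDerivAt
  have hpair : HasMFDerivAt (𝓡 m) 𝓘(ℝ, EuclideanSpace ℝ (Fin m) × EuclideanSpace ℝ (Fin m))
      (fun a : G => (adInv Y a, adInv Z a)) 1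
      ((mvfderiv (𝓡 m) (adInv Y) 1).prod (mvfderiv (𝓡 m) (adInv Z) 1)) :=
    ⟨hY.1.prodMk hZ.1, hY.2.prodMk hZ.2⟩
  have hderiv := DFunLike.congr_fun
    ((Q.isBoundedBilinearMap.hasFDerivAt (adInv Y (1 : G), adInv Z (1 : G))).hasMFDerivAt.comp
      (1 : G) hpair).mfderiv X
  calc mvfderiv (𝓡 m) (fun a : G => Q (adInv Y a) (adInv Z a)) 1 X
      = Q (adInv Y (1 : G)) (adInvDeriv X Z) + Q (adInvDeriv X Y) (adInv Z (1 : G)) := hderiv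
    _ = Q Y (-⁅X, Z⁆ : GroupLieAlgebra (𝓡 m) G) + Q (-⁅X, Y⁆ : GroupLieAlgebra (𝓡 m) G) Z := by
        rw [adInvDeriv_eq_neg_lie, adInvDeriv_eq_neg_lie, adInv_one, adInv_one]
    _ = _ := by
        rw [add_comm, sub_eq_add_neg]
        exact congrArg₂ (· + ·) (DFunLike.congr_fun (map_neg Q _) Z) (map_neg (Q Y) _)

namespace IsSmoothAction

variable {act : G → M → M} (h : IsSmoothAction m n act)
include h

theorem isKillingFamily (g : Metric n M)
    (hinv : ∀ (a : G) (y : M) (v w : EuclideanSpace ℝ (Fin n)),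
      g.inner (act a y) (mderiv (𝓡 n) (𝓡 n) (act a) y v) (mderiv (𝓡 n) (𝓡 n) (act a) y w) =
        g.inner y v w) :
    IsKillingFamily g (fundField (m := m) act) where
  add := fundField_add act
  smul := fundField_smul act
  smooth := h.isSmoothField_fundField
  bracket := h.mlieBracket_fundField
  killing X Y Z y := by
    let D : EuclideanSpace ℝ (Fin m) →L[ℝ] EuclideanSpace ℝ (Fin n) :=
      mderiv (𝓡 m) (𝓡 n) (fun b : G => act b y) 1
    let gy : EuclideanSpace ℝ (Fin n) →L[ℝ] EuclideanSpace ℝ (Fin n) →L[ℝ] ℝ := g.inner y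
    have hpull : (fun q => g.inner q (fundField (m := m) act Y q) (fundField (m := m) act Z q)) ∘
        (fun a : G => act a y) = fun a => gy.bilinearComp D D (adInv Y a) (adInv Z a) := by
      funext a
      have hequiv := hinv a y (fundField act (adInv Y a) y) (fundField act (adInv Z a) y)
      rw [h.mderiv_fundField_adInv, h.mderiv_fundField_adInv] at hequiv
      exact hequiv
    have hsmooth := contMDiff_inner g (h.isSmoothField_fundField Y) (h.isSmoothField_fundField Z)
    have hchain := (h.isRelated_rightField X y).mvfderiv_comp (x := (1 : G))
      (hsmooth.mdifferentiable (by simp) _) ((h.contMDiff_left y).mdifferentiable (by simp) _)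
    rw [hpull, rightField_one, mvfderiv_bilinear_adInv, h.one] at hchain
    exact hchain.symm

end IsSmoothAction

end KillingFields

section Curvature

variable {n : ℕ} {M : Type*} [TopologicalSpace M] [ChartedSpace (EuclideanSpace ℝ (Fin n)) M]
  [IsManifold (𝓡 n) ∞ M]

lemma IsLeviCivita.isSmoothField {g : Metric n M} {cov : Connection n M} (h : IsLeviCivita g cov)
    {Y Z : ∀ y : M, TangentSpace (𝓡 n) y} (hY : IsSmoothField Y) (hZ : IsSmoothField Z) :
    IsSmoothField (fun q => cov Z q (Y q)) := fun x =>
  ContMDiffAt.clm_bundle_apply (F₁ := EuclideanSpace ℝ (Fin n)) (F₂ := EuclideanSpace ℝ (Fin n))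
    (contMDiffOn_univ.1 (h.smooth.contMDiff.contMDiff (σ := Z) hZ.contMDiffOn) x) (hY x)

variable {L : Type*} [LieRing L] [LieAlgebra ℝ L]

/-- The derivative of `g(A, B)` along `X`, for Killing fields `A`, `B`, `X`. -/
def killingDeriv (g : Metric n M) (K : L → ∀ y : M, TangentSpace (𝓡 n) y) (y : M) (X A B : L) :
    ℝ :=
  -g.inner y (K ⁅X, A⁆ y) (K B y) - g.inner y (K A y) (K ⁅X, B⁆ y)

/-- The Koszul expression for `g(∇_X Y, Z)`, for Killing fields `X`, `Y`, `Z`. -/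
def koszul (g : Metric n M) (K : L → ∀ y : M, TangentSpace (𝓡 n) y) (y : M) (X Y Z : L) : ℝ :=
  -(g.inner y (K ⁅X, Y⁆ y) (K Z y) + g.inner y (K ⁅X, Z⁆ y) (K Y y)
    + g.inner y (K X y) (K ⁅Y, Z⁆ y)) / 2

/-- The derivative of `koszul` along a Killing field `A`. -/
def koszulDeriv (g : Metric n M) (K : L → ∀ y : M, TangentSpace (𝓡 n) y) (y : M) (A X Y Z : L) :
    ℝ :=
  -(killingDeriv g K y A ⁅X, Y⁆ Z + killingDeriv g K y A ⁅X, Z⁆ Y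
    + killingDeriv g K y A X ⁅Y, Z⁆) / 2

namespace IsKillingFamily

variable {g : Metric n M} {K : L → ∀ y : M, TangentSpace (𝓡 n) y} (hK : IsKillingFamily g K)
  {cov : Connection n M} (hcov : IsLeviCivita g cov)
include hK

lemma neg (X : L) (y : M) : K (-X) y = -K X y := by
  rw [← neg_one_smul ℝ X, hK.smul, neg_one_smul]

lemma inner_neg_left (X : L) (y : M) (v : TangentSpace (𝓡 n) y) :
    g.inner y (K (-X) y) v = -g.inner y (K X y) v := by
  rw [hK.neg, map_neg, neg_apply]

lemma inner_neg_right (X : L) (y : M) (v : TangentSpace (𝓡 n) y) :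
    g.inner y v (K (-X) y) = -g.inner y v (K X y) := by
  rw [hK.neg, map_neg]

lemma mvfderiv_koszul (A X Y Z : L) (y : M) :
    mvfderiv (𝓡 n) (fun q => koszul g K q X Y Z) y (K A y) = koszulDeriv g K y A X Y Z := by
  have hinner : ∀ U V : L, HasMFDerivAt (𝓡 n) 𝓘(ℝ, ℝ) (fun q => g.inner q (K U q) (K V q)) y
      (mvfderiv (𝓡 n) (fun q => g.inner q (K U q) (K V q)) y) := fun U V =>
    ((contMDiff_inner g (hK.smooth U) (hK.smooth V)).mdifferentiable (by simp) y).hasMFDerivAt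
  have hkoszul := (((hinner ⁅X, Y⁆ Z).add (hinner ⁅X, Z⁆ Y)).add (hinner X ⁅Y, Z⁆)).const_smul
    (-1 / 2 : ℝ)
  have hfun : (fun q => koszul g K q X Y Z) = (-1 / 2 : ℝ) •
      (((fun q => g.inner q (K ⁅X, Y⁆ q) (K Z q)) + fun q => g.inner q (K ⁅X, Z⁆ q) (K Y q)) +
        fun q => g.inner q (K X q) (K ⁅Y, Z⁆ q)) := by
    funext q
    simp only [koszul, Pi.smul_apply, Pi.add_apply, smul_eq_mul]
    ring
  have hderiv : mvfderiv (𝓡 n) (fun q => koszul g K q X Y Z) y (K A y) = (-1 / 2 : ℝ) *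
      (mvfderiv (𝓡 n) (fun q => g.inner q (K ⁅X, Y⁆ q) (K Z q)) y (K A y) +
        mvfderiv (𝓡 n) (fun q => g.inner q (K ⁅X, Z⁆ q) (K Y q)) y (K A y) +
        mvfderiv (𝓡 n) (fun q => g.inner q (K X q) (K ⁅Y, Z⁆ q)) y (K A y)) := by
    rw [hfun]
    exact DFunLike.congr_fun hkoszul.mfderiv (K A y)
  rw [hderiv, hK.killing, hK.killing, hK.killing, koszulDeriv]
  simp only [killingDeriv]
  ring

include hcov

lemma torsion (X Y : L) (y : M) :
    cov (K Y) y (K X y) - cov (K X) y (K Y y) = -K ⁅X, Y⁆ y := by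
  rw [← hK.bracket]
  exact cov.torsion_eq_zero_iff.1 hcov.torsion_eq_zero
    ((hK.smooth X).mdifferentiable (by simp) y) ((hK.smooth Y).mdifferentiable (by simp) y)

lemma inner_torsion (X Y Z : L) (y : M) :
    g.inner y (cov (K Y) y (K X y)) (K Z y) - g.inner y (cov (K X) y (K Y y)) (K Z y) =
      -g.inner y (K ⁅X, Y⁆ y) (K Z y) := by
  simpa only [map_sub, map_neg, sub_apply, neg_apply] using
    congrArg (fun v => g.inner y v (K Z y)) (hK.torsion hcov X Y y)

lemma metric (X Y Z : L) (y : M) : killingDeriv g K y X Y Z =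
    g.inner y (cov (K Y) y (K X y)) (K Z y) + g.inner y (K Y y) (cov (K Z) y (K X y)) :=
  (hK.killing X Y Z y).symm.trans (hcov.metric _ _ (hK.smooth Y) (hK.smooth Z) y (K X y))

theorem inner_cov (X Y Z : L) (y : M) :
    g.inner y (cov (K Y) y (K X y)) (K Z y) = koszul g K y X Y Z := by
  have hX := hK.metric hcov X Y Z y
  have hY := hK.metric hcov Y Z X y
  have hZ := hK.metric hcov Z X Y y
  have hXY := hK.inner_torsion hcov X Y Z y
  have hYZ := hK.inner_torsion hcov Y Z X y
  have hZX := hK.inner_torsion hcov Z X Y y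
  have hskew : ∀ A B C : L, g.inner y (K ⁅A, B⁆ y) (K C y) = -g.inner y (K ⁅B, A⁆ y) (K C y) :=
    fun A B C => by rw [← lie_skew, hK.inner_neg_left]
  simp only [killingDeriv, g.symm y (K _ y) (K ⁅_, _⁆ y), g.symm y (K _ y) (cov _ y _)] at hX hY hZ
  simp only [koszul, g.symm y (K _ y) (K ⁅_, _⁆ y)]
  linarith [hskew X Y Z, hskew Y Z X]

lemma inner_cov_cov (A X Y Z : L) (y : M) :
    g.inner y (cov (fun q => cov (K Y) q (K X q)) y (K A y)) (K Z y) =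
      koszulDeriv g K y A X Y Z - g.inner y (cov (K Y) y (K X y)) (cov (K Z) y (K A y)) := by
  have hmetric := hcov.metric _ _ (hcov.isSmoothField (hK.smooth X) (hK.smooth Y)) (hK.smooth Z) y
    (K A y)
  have hderiv := hK.mvfderiv_koszul A X Y Z y
  simp only [← hK.inner_cov hcov] at hderiv
  exact eq_sub_of_add_eq (hmetric.symm.trans hderiv)

theorem inner_curvature {R : ∀ y : M, TangentSpace (𝓡 n) y →ₗ[ℝ] TangentSpace (𝓡 n) y →ₗ[ℝ]
      TangentSpace (𝓡 n) y →ₗ[ℝ] TangentSpace (𝓡 n) y} (hR : IsCurvatureTensor cov R)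
    (X Y Z W : L) (y : M) :
    g.inner y (R y (K X y) (K Y y) (K Z y)) (K W y) =
      koszulDeriv g K y X Y Z W - g.inner y (cov (K Z) y (K Y y)) (cov (K W) y (K X y))
        - (koszulDeriv g K y Y X Z W - g.inner y (cov (K Z) y (K X y)) (cov (K W) y (K Y y)))
        + koszul g K y ⁅X, Y⁆ Z W := by
  rw [hR _ _ _ (hK.smooth X) (hK.smooth Y) (hK.smooth Z), hK.bracket, map_neg, sub_neg_eq_add,
    ← hK.inner_cov_cov hcov, ← hK.inner_cov_cov hcov, ← hK.inner_cov hcov]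
  simp only [map_sub, map_add, sub_apply, add_apply]

end IsKillingFamily

end Curvature

section OrthogonalBasis

variable {V J : Type*} [AddCommGroup V] [Module ℝ V] [DecidableEq J]
  (b : Module.Basis J ℝ V) (G : V →ₗ[ℝ] V →ₗ[ℝ] ℝ) {x : J → ℝ}
  (hG : ∀ i j, G (b i) (b j) = if i = j then x i else 0)
include hG

lemma apply_eq_repr_mul_of_orthogonal [Finite J] (v : V) (i : J) :
    G v (b i) = b.repr v i * x i := by
  have := Fintype.ofFinite J
  have h := congrArg (fun w => G w (b i)) (b.sum_repr v)
  simp only [map_sum, LinearMap.sum_apply, map_smul, LinearMap.smul_apply, hG, smul_eq_mul,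
    mul_ite, mul_zero, Finset.sum_ite_eq', Finset.mem_univ, if_true] at h
  exact h.symm

lemma trace_eq_sum_of_orthogonal [Fintype J] (hx : ∀ i, 0 < x i) (f : V →ₗ[ℝ] V) :
    LinearMap.trace ℝ V f = ∑ i, G (f (b i)) (b i) / x i := by
  rw [LinearMap.trace_eq_matrix_trace ℝ b, Matrix.trace]
  refine Finset.sum_congr rfl fun i _ => ?_
  rw [apply_eq_repr_mul_of_orthogonal b G hG, Matrix.diag_apply, LinearMap.toMatrix_apply,
    mul_div_cancel_right₀ _ (hx i).ne']

lemma parseval_of_orthogonal [Fintype J] (hx : ∀ i, 0 < x i) (v w : V) :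
    G v w = ∑ i, G v (b i) * G w (b i) / x i := by
  conv_lhs => rw [← b.sum_repr w]
  rw [map_sum]
  refine Finset.sum_congr rfl fun i _ => ?_
  rw [map_smul, smul_eq_mul, apply_eq_repr_mul_of_orthogonal b G hG w]
  field_simp [(hx i).ne']

lemma pos_of_orthogonal [Finite J] (hx : ∀ i, 0 < x i) {v : V} (hv : v ≠ 0) : 0 < G v v := by
  have := Fintype.ofFinite J
  obtain ⟨i, hi⟩ : ∃ i, b.repr v i ≠ 0 := by
    by_contra! hzero
    exact hv (b.repr.map_eq_zero_iff.1 (Finsupp.ext hzero))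
  have hvi : G v (b i) ≠ 0 := by
    rw [apply_eq_repr_mul_of_orthogonal b G hG]
    exact mul_ne_zero hi (hx i).ne'
  rw [parseval_of_orthogonal b G hG hx]
  exact Finset.sum_pos' (fun j _ => div_nonneg (mul_self_nonneg _) (hx j).le)
    ⟨i, Finset.mem_univ i, div_pos (mul_self_pos.2 hvi) (hx i)⟩

end OrthogonalBasis

section OrthonormalFrame

variable {V J : Type*} [AddCommGroup V] [Module ℝ V] [Fintype J] {B : LinearMap.BilinForm ℝ V}
  {e : J → V}

/-- The `B`-orthogonal projection onto the span of a `B`-orthonormal family `e`. -/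
def frameProj (B : LinearMap.BilinForm ℝ V) (e : J → V) : V →ₗ[ℝ] V :=
  ∑ c, (B.flip (e c)).smulRight (e c)

/-- The squared length of the component of `u` that is `B`-orthogonal to an orthonormal family
`e`. -/
def normalSq (B : LinearMap.BilinForm ℝ V) (e : J → V) (u : V) : ℝ :=
  B u u - ∑ c, B u (e c) ^ 2

lemma frameProj_apply (u : V) : frameProj B e u = ∑ c, B u (e c) • e c := by
  simp only [frameProj, LinearMap.sum_apply, LinearMap.smulRight_apply,
    LinearMap.BilinForm.flip_apply]

lemma trace_frameProj_comp [FiniteDimensional ℝ V] (f : V →ₗ[ℝ] V) :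
    LinearMap.trace ℝ V (frameProj B e ∘ₗ f) = ∑ c, B (f (e c)) (e c) := by
  have hsum : frameProj B e ∘ₗ f = ∑ c, (B.flip (e c) ∘ₗ f).smulRight (e c) := by
    ext v
    simp [frameProj]
  rw [hsum, map_sum]
  exact Finset.sum_congr rfl fun c _ => LinearMap.trace_smulRight _ _

lemma apply_sub_frameProj_self (hsymm : ∀ u v, B u v = B v u) (u : V) :
    B (u - frameProj B e u) u = normalSq B e u := by
  simp only [frameProj_apply, map_sub, map_sum, map_smul, LinearMap.sub_apply,
    LinearMap.sum_apply, LinearMap.smul_apply, smul_eq_mul, normalSq, sq,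
    fun c => hsymm (e c) u]

lemma apply_frameProj_frameProj_of_orthogonal [DecidableEq J] {q : LinearMap.BilinForm ℝ V}
    {x : J → ℝ} (hq : ∀ b c, q (e b) (e c) = if b = c then x b else 0) (u v : V) :
    q (frameProj B e u) (frameProj B e v) = ∑ c, x c * (B u (e c) * B v (e c)) := by
  simp only [frameProj_apply, map_sum, map_smul, LinearMap.sum_apply, LinearMap.smul_apply, hq,
    smul_eq_mul, mul_ite, mul_zero, Finset.sum_ite_eq', Finset.mem_univ, if_true]
  exact Finset.sum_congr rfl fun c _ => by ring

variable [DecidableEq J] (horth : ∀ a b, B (e a) (e b) = if a = b then 1 else 0)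
include horth

lemma apply_sub_frameProj (u : V) (c : J) : B (u - frameProj B e u) (e c) = 0 := by
  simp only [frameProj_apply, map_sub, map_sum, map_smul, LinearMap.sub_apply,
    LinearMap.sum_apply, LinearMap.smul_apply, smul_eq_mul, horth, mul_ite, mul_one, mul_zero,
    Finset.sum_ite_eq', Finset.mem_univ, if_true, sub_self]

lemma apply_sub_frameProj_sub_frameProj (u v : V) :
    B (u - frameProj B e u) (v - frameProj B e v) = B (u - frameProj B e u) v := by
  rw [map_sub, frameProj_apply v, map_sum, sub_eq_self]
  exact Finset.sum_eq_zero fun c _ => by rw [map_smul, apply_sub_frameProj horth, smul_zero]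

end OrthonormalFrame

section Ricci

variable {n : ℕ} {M : Type*} [TopologicalSpace M] [ChartedSpace (EuclideanSpace ℝ (Fin n)) M]
  [IsManifold (𝓡 n) ∞ M] {L : Type*} [LieRing L] [LieAlgebra ℝ L]
  {J : Type*} [Fintype J]

/-- The metric at `y` as a bilinear form. -/
def metricForm (g : Metric n M) (y : M) :
    TangentSpace (𝓡 n) y →ₗ[ℝ] TangentSpace (𝓡 n) y →ₗ[ℝ] ℝ :=
  LinearMap.mk₂ ℝ (fun v w => g.inner y v w) (fun _ _ _ => by rw [map_add, add_apply])
    (fun _ _ _ => by rw [map_smul, smul_apply]) (fun _ _ _ => map_add _ _ _)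
    (fun _ _ _ => map_smul _ _ _)

variable [DecidableEq J]

/-- At the point `y`, the Killing fields `K (e c)` form an orthogonal basis, and the metric is
diagonal with respect to the invariant form `B`. -/
structure IsDiagonalAt (g : Metric n M) (K : L → ∀ y : M, TangentSpace (𝓡 n) y) (y : M)
    (B : LinearMap.BilinForm ℝ L) (e : J → L) (x : J → ℝ) : Prop where
  symm : ∀ U V, B U V = B V U
  lie : ∀ U V W, B ⁅U, V⁆ W = B U ⁅V, W⁆
  orthonormal : ∀ a b, B (e a) (e b) = if a = b then 1 else 0
  pos : ∀ a, 0 < x a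
  inner : ∀ U V, g.inner y (K U y) (K V y) = ∑ c, x c * (B U (e c) * B V (e c))
  surjective : ∀ v : TangentSpace (𝓡 n) y, ∃ U, K U y = v

namespace IsDiagonalAt

variable {g : Metric n M} {K : L → ∀ y : M, TangentSpace (𝓡 n) y} {y : M}
  {B : LinearMap.BilinForm ℝ L} {e : J → L} {x : J → ℝ}
  (hD : IsDiagonalAt g K y B e x) (hK : IsKillingFamily g K)
include hD

lemma lie_swap (U V W : L) : B ⁅U, V⁆ W = -B ⁅U, W⁆ V := by
  rw [← lie_skew, map_neg, LinearMap.neg_apply, hD.lie, hD.symm]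

lemma lie_rotate (U V W : L) : B ⁅U, V⁆ W = B ⁅V, W⁆ U := by
  rw [hD.lie, hD.symm]

lemma inner_left (U : L) (a : J) : g.inner y (K U y) (K (e a) y) = x a * B U (e a) := by
  simp only [hD.inner, hD.orthonormal, mul_ite, mul_one, mul_zero, Finset.sum_ite_eq,
    Finset.mem_univ, if_true]

lemma inner_right (U : L) (a : J) : g.inner y (K (e a) y) (K U y) = x a * B U (e a) := by
  rw [g.symm, hD.inner_left]

lemma inner_basis (a b : J) : g.inner y (K (e a) y) (K (e b) y) = if a = b then x a else 0 := by
  rw [hD.inner_right, hD.orthonormal, mul_ite, mul_one, mul_zero]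
  simp only [eq_comm]

lemma inner_self (U : L) : g.inner y (K U y) (K U y) = ∑ c, x c * B U (e c) ^ 2 := by
  simp only [hD.inner, sq]

lemma apply_eq_zero {U : L} (hU : ∀ c, B U (e c) = 0) : K U y = 0 := by
  by_contra hne
  have hpos := g.pos y _ hne
  simp only [hD.inner, hU, mul_zero, Finset.sum_const_zero, lt_self_iff_false] at hpos

lemma apply_sub_frameProj_eq_zero (U : L) : K (U - frameProj B e U) y = 0 :=
  hD.apply_eq_zero (apply_sub_frameProj hD.orthonormal U)

lemma koszul_basis (a b c : J) : koszul g K y (e a) (e b) (e c) =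
    -(x a - x b + x c) / 2 * B ⁅e a, e b⁆ (e c) := by
  rw [koszul, hD.inner_left, hD.inner_left, hD.inner_right, hD.lie_swap (e a) (e c),
    ← hD.lie_rotate (e a)]
  ring

include hK

lemma lie_subalgebra {U V : L} (hU : ∀ c, B U (e c) = 0) (hV : ∀ c, B V (e c) = 0) (c : J) :
    B ⁅U, V⁆ (e c) = 0 := by
  have hderiv := hK.killing U V (e c) y
  rw [hD.apply_eq_zero hU, map_zero, g.symm y (K V y), hD.apply_eq_zero hV, map_zero,
    hD.inner_left, sub_zero] at hderiv
  exact (mul_eq_zero.1 (neg_eq_zero.1 hderiv.symm)).resolve_left (hD.pos c).ne'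

lemma apply_eq_sum (U : L) : K U y = ∑ c, B U (e c) • K (e c) y := by
  let Ky : L →ₗ[ℝ] TangentSpace (𝓡 n) y :=
    { toFun := fun U => K U y
      map_add' := fun U V => hK.add U V y
      map_smul' := fun c U => hK.smul c U y }
  have hsum : Ky (U - frameProj B e U) = 0 := hD.apply_sub_frameProj_eq_zero U
  simp only [frameProj_apply, map_sub, map_sum, map_smul, sub_eq_zero] at hsum
  exact hsum

lemma exists_basis : ∃ b : Module.Basis J ℝ (TangentSpace (𝓡 n) y), ∀ a, b a = K (e a) y := by
  have hli : LinearIndependent ℝ (fun a => K (e a) y) := by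
    rw [Fintype.linearIndependent_iff]
    intro f hf i
    have hcoeff := congrArg (fun v => g.inner y v (K (e i) y)) hf
    simp only [map_sum, map_smul, map_zero, sum_apply, smul_apply, zero_apply, hD.inner_basis,
      smul_eq_mul, mul_ite, mul_zero, Finset.sum_ite_eq', Finset.mem_univ, if_true] at hcoeff
    exact (mul_eq_zero.1 hcoeff).resolve_right (hD.pos i).ne'
  refine ⟨Module.Basis.mk hli fun v _ => ?_, fun a => by simp⟩
  obtain ⟨U, rfl⟩ := hD.surjective v
  rw [hD.apply_eq_sum hK U]
  exact Submodule.sum_mem _ fun c _ => Submodule.smul_mem _ _ (Submodule.subset_span ⟨c, rfl⟩)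

lemma exists_orthogonal_basis : ∃ b : Module.Basis J ℝ (TangentSpace (𝓡 n) y),
    (∀ a, b a = K (e a) y) ∧ ∀ i j, metricForm g y (b i) (b j) = if i = j then x i else 0 := by
  obtain ⟨b, hb⟩ := hD.exists_basis hK
  exact ⟨b, hb, fun i j => by rw [hb, hb]; exact hD.inner_basis i j⟩

lemma inner_eq_sum (v w : TangentSpace (𝓡 n) y) :
    g.inner y v w = ∑ c, g.inner y v (K (e c) y) * g.inner y w (K (e c) y) / x c := by
  obtain ⟨b, hb, horth⟩ := hD.exists_orthogonal_basis hK
  simp only [← hb]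
  exact parseval_of_orthogonal b (metricForm g y) horth hD.pos v w

-- The Killing field `K Z` of the component `Z` of `⁅e b, e a⁆` normal to `e` vanishes at `y`, so
-- the derivative of `g(K (e b), K (e a))` along it vanishes too.
lemma mul_normalSq_eq_zero (a b : J) : (x a - x b) * normalSq B e ⁅e b, e a⁆ = 0 := by
  set Z := ⁅e b, e a⁆ - frameProj B e ⁅e b, e a⁆ with hZ
  have hderiv := hK.killing Z (e b) (e a) y
  rw [hD.apply_sub_frameProj_eq_zero, map_zero, hD.inner_left, hD.inner_right,
    hD.lie_swap Z (e a), hD.lie, hZ, apply_sub_frameProj_self hD.symm] at hderiv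
  linear_combination hderiv

lemma koszul_lie_basis (a b : J) : koszul g K y ⁅e b, e a⁆ (e a) (e b) =
    ((x b - x a) * B ⁅e b, e a⁆ ⁅e b, e a⁆ + g.inner y (K ⁅e b, e a⁆ y) (K ⁅e b, e a⁆ y)) / 2 := by
  rw [koszul, hD.inner_left, hD.inner_left, ← lie_skew (e a) (e b), hK.inner_neg_right,
    hD.lie_swap ⁅e b, e a⁆ (e a), hD.lie ⁅e b, e a⁆]
  ring

lemma koszulDeriv_basis_sub (a b : J) :
    koszulDeriv g K y (e b) (e a) (e a) (e b) - koszulDeriv g K y (e a) (e b) (e a) (e b) =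
      x a * B ⁅e b, e a⁆ ⁅e b, e a⁆ - g.inner y (K ⁅e b, e a⁆ y) (K ⁅e b, e a⁆ y) := by
  have hzero : ∀ v : TangentSpace (𝓡 n) y, g.inner y (K (0 : L) y) v = 0 := fun v => by
    rw [← zero_smul ℝ (0 : L), hK.smul, zero_smul, map_zero, zero_apply]
  have hlie : B ⁅e b, ⁅e b, e a⁆⁆ (e a) = -B ⁅e b, e a⁆ ⁅e b, e a⁆ := hD.lie_swap _ _ _
  simp only [koszulDeriv, killingDeriv, lie_self, ← lie_skew (e a) (e b), lie_neg, lie_zero, hzero,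
    hK.inner_neg_left, hK.inner_neg_right, hD.inner_left, hD.inner_right, hlie]
  ring

variable {cov : Connection n M} (hcov : IsLeviCivita g cov)
include hcov

lemma inner_cov_self_left (a : J) (v : TangentSpace (𝓡 n) y) :
    g.inner y (cov (K (e a)) y (K (e a) y)) v = 0 := by
  rw [hD.inner_eq_sum hK]
  simp only [hK.inner_cov hcov, hD.koszul_basis, lie_self, map_zero, LinearMap.zero_apply,
    mul_zero, zero_mul, zero_div, Finset.sum_const_zero]

lemma inner_cov_basis (a b : J) :
    g.inner y (cov (K (e a)) y (K (e b) y)) (cov (K (e b)) y (K (e a) y)) =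
      ∑ c, B ⁅e b, e a⁆ (e c) ^ 2 * ((x a - x b) ^ 2 / (4 * x c) - x c / 4) := by
  rw [hD.inner_eq_sum hK]
  refine Finset.sum_congr rfl fun c _ => ?_
  have hc := (hD.pos c).ne'
  rw [hK.inner_cov hcov, hK.inner_cov hcov, hD.koszul_basis, hD.koszul_basis,
    ← lie_skew (e a) (e b), map_neg, LinearMap.neg_apply]
  field_simp
  ring

variable {R : ∀ y : M, TangentSpace (𝓡 n) y →ₗ[ℝ] TangentSpace (𝓡 n) y →ₗ[ℝ]
  TangentSpace (𝓡 n) y →ₗ[ℝ] TangentSpace (𝓡 n) y} (hR : IsCurvatureTensor cov R)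
include hR

theorem inner_curvature_basis (a b : J) :
    g.inner y (R y (K (e b) y) (K (e a) y) (K (e a) y)) (K (e b) y) =
      normalSq B e ⁅e b, e a⁆ * x b + ∑ c, B ⁅e b, e a⁆ (e c) ^ 2 *
        ((x a + x b) / 2 - 3 / 4 * x c + (x a - x b) ^ 2 / (4 * x c)) := by
  have hkoszul := hD.koszulDeriv_basis_sub hK a b
  have hnormal := hD.mul_normalSq_eq_zero hK a b
  have hself : B ⁅e b, e a⁆ ⁅e b, e a⁆ =
      normalSq B e ⁅e b, e a⁆ + ∑ c, B ⁅e b, e a⁆ (e c) ^ 2 := (sub_add_cancel _ _).symm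
  have hsum : ∑ c, B ⁅e b, e a⁆ (e c) ^ 2 *
        ((x a + x b) / 2 - 3 / 4 * x c + (x a - x b) ^ 2 / (4 * x c)) =
      (x a + x b) / 2 * ∑ c, B ⁅e b, e a⁆ (e c) ^ 2 - (∑ c, x c * B ⁅e b, e a⁆ (e c) ^ 2) / 2 +
        ∑ c, B ⁅e b, e a⁆ (e c) ^ 2 * ((x a - x b) ^ 2 / (4 * x c) - x c / 4) := by
    rw [Finset.mul_sum, Finset.sum_div, ← Finset.sum_sub_distrib, ← Finset.sum_add_distrib]
    exact Finset.sum_congr rfl fun c _ => by ring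
  rw [hK.inner_curvature hcov hR, hD.inner_cov_self_left hK hcov, hD.inner_cov_basis hK hcov,
    hD.koszul_lie_basis hK, hsum]
  rw [hself, hD.inner_self] at hkoszul ⊢
  linear_combination hkoszul + (1 / 2 : ℝ) * hnormal

theorem trace_curvature (a : J) :
    LinearMap.trace ℝ (TangentSpace (𝓡 n) y) (((R y).flip (K (e a) y)).flip (K (e a) y)) =
      ∑ b, (normalSq B e ⁅e b, e a⁆ + (∑ c, B ⁅e b, e a⁆ (e c) ^ 2 *
        ((x a + x b) / 2 - 3 / 4 * x c + (x a - x b) ^ 2 / (4 * x c))) / x b) := by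
  obtain ⟨bas, hbas, horth⟩ := hD.exists_orthogonal_basis hK
  rw [trace_eq_sum_of_orthogonal bas (metricForm g y) horth hD.pos]
  refine Finset.sum_congr rfl fun b _ => ?_
  rw [hbas]
  refine (congrArg (· / x b) (hD.inner_curvature_basis hK hcov hR a b)).trans ?_
  rw [add_div, mul_div_cancel_right₀ _ (hD.pos b).ne']

end IsDiagonalAt

end Ricci

section KillingTrace

lemma comp_self_eq_of_frame {V : Type*} [AddCommGroup V] [Module ℝ V] {P f : V →ₗ[ℝ] V}
    (hf : ∀ v, P (f (v - P v)) = f (v - P v)) :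
    f ∘ₗ f = P ∘ₗ (f ∘ₗ f) + (f - P ∘ₗ f) ∘ₗ (P ∘ₗ f) := by
  ext v
  have hv := hf (f v)
  simp only [LinearMap.add_apply, LinearMap.comp_apply, LinearMap.sub_apply, map_sub] at hv ⊢
  rw [sub_eq_sub_iff_add_eq_add] at hv
  rw [← add_sub_assoc, eq_sub_iff_add_eq, add_comm, hv, add_comm]

lemma trace_comp_self_of_skew {V J : Type*} [AddCommGroup V] [Module ℝ V] [FiniteDimensional ℝ V]
    [Fintype J] {B : LinearMap.BilinForm ℝ V} {e : J → V} {f : V →ₗ[ℝ] V}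
    (hsymm : ∀ u v, B u v = B v u) (hskew : ∀ u v, B (f u) v = -B u (f v))
    (hf : ∀ v, frameProj B e (f (v - frameProj B e v)) = f (v - frameProj B e v)) :
    LinearMap.trace ℝ V (f ∘ₗ f) =
      -∑ b, (2 * normalSq B e (f (e b)) + ∑ c, B (f (e b)) (e c) ^ 2) := by
  rw [comp_self_eq_of_frame hf, map_add, trace_frameProj_comp, LinearMap.trace_comp_comm',
    LinearMap.comp_assoc, trace_frameProj_comp, ← Finset.sum_add_distrib, ← Finset.sum_neg_distrib]
  refine Finset.sum_congr rfl fun b _ => ?_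
  have hnormal : B ((f ∘ₗ (f - frameProj B e ∘ₗ f)) (e b)) (e b) = -normalSq B e (f (e b)) := by
    rw [LinearMap.comp_apply, hskew]
    exact congrArg Neg.neg (apply_sub_frameProj_self hsymm _)
  rw [hnormal, LinearMap.comp_apply, hskew, normalSq]
  ring

/-- The opposite of the Killing form. -/
def killingProduct (L : Type*) [LieRing L] [LieAlgebra ℝ L] : LinearMap.BilinForm ℝ L :=
  -killingForm ℝ L

variable {L : Type*} [LieRing L] [LieAlgebra ℝ L]

lemma killingProduct_comm (U V : L) : killingProduct L U V = killingProduct L V U :=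
  congrArg Neg.neg (LieModule.traceForm_comm ℝ _ _ U V)

lemma killingProduct_lie (U V W : L) : killingProduct L ⁅U, V⁆ W = killingProduct L U ⁅V, W⁆ :=
  congrArg Neg.neg (LieModule.traceForm_apply_lie_apply ℝ _ _ U V W)

variable {J : Type*} [Fintype J] [DecidableEq J] {e : J → L}
  (hpos : ∀ U : L, U ≠ 0 → 0 < killingProduct L U U)
  (horth : ∀ a b, killingProduct L (e a) (e b) = if a = b then 1 else 0)
include hpos horth

lemma normalSq_nonneg (U : L) : 0 ≤ normalSq (killingProduct L) e U := by
  rw [← apply_sub_frameProj_self killingProduct_comm, ← apply_sub_frameProj_sub_frameProj horth]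
  by_cases hU : U - frameProj (killingProduct L) e U = 0
  · rw [hU, map_zero]
  · exact (hpos _ hU).le

variable (hsub : ∀ U V, (∀ c, killingProduct L U (e c) = 0) →
  (∀ c, killingProduct L V (e c) = 0) → ∀ c, killingProduct L ⁅U, V⁆ (e c) = 0)
include hsub

lemma frameProj_lie_eq {U : L} (hU : ∀ c, killingProduct L U (e c) = 0) (a : J) :
    frameProj (killingProduct L) e ⁅U, e a⁆ = ⁅U, e a⁆ := by
  have hnormal := apply_sub_frameProj horth ⁅U, e a⁆
  set W := ⁅U, e a⁆ - frameProj (killingProduct L) e ⁅U, e a⁆ with hW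
  have hself : killingProduct L W W = 0 := by
    rw [hW, apply_sub_frameProj_sub_frameProj horth, ← hW, ← killingProduct_lie,
      hsub W U hnormal hU]
  by_contra hne
  exact (hpos W (sub_ne_zero.2 (Ne.symm hne))).ne' hself

theorem sum_normalSq_lie [FiniteDimensional ℝ L] (a : J) :
    ∑ b, (2 * normalSq (killingProduct L) e ⁅e b, e a⁆ +
      ∑ c, killingProduct L ⁅e b, e a⁆ (e c) ^ 2) = 1 := by
  let f : L →ₗ[ℝ] L := -LieAlgebra.ad ℝ L (e a)
  have hf : ∀ U, f U = ⁅U, e a⁆ := fun U => lie_skew U (e a)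
  have htrace := trace_comp_self_of_skew (B := killingProduct L) (e := e) (f := f)
    killingProduct_comm
    (fun U V => by rw [hf, hf, killingProduct_lie, ← lie_skew, map_neg])
    (fun U => by rw [hf, frameProj_lie_eq hpos horth hsub (apply_sub_frameProj horth U)])
  have hkilling : LinearMap.trace ℝ L (f ∘ₗ f) = -killingProduct L (e a) (e a) := by
    simp only [f, LinearMap.neg_comp, LinearMap.comp_neg, neg_neg, killingProduct,
      LinearMap.neg_apply, killingForm_apply_apply]
  rw [hkilling, horth, if_pos rfl, neg_inj] at htrace
  simpa only [hf] using htrace.symm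

end KillingTrace

section StructureConstants

variable {L : Type*} [LieRing L] [LieAlgebra ℝ L] {d : Fin 3 → ℕ} {B : LinearMap.BilinForm ℝ L}
  {e : (Σ i, Fin (d i)) → L}

/-- The sum of the squares of the structure constants with indices in three given modules. -/
def structureSum (B : LinearMap.BilinForm ℝ L) (e : (Σ i, Fin (d i)) → L) (i j k : Fin 3) : ℝ :=
  ∑ α, ∑ β, ∑ γ, B ⁅e ⟨i, α⟩, e ⟨j, β⟩⁆ (e ⟨k, γ⟩) ^ 2

lemma structureSum_nonneg (i j k : Fin 3) : 0 ≤ structureSum B e i j k :=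
  Finset.sum_nonneg fun _ _ => Finset.sum_nonneg fun _ _ => Finset.sum_nonneg fun _ _ => sq_nonneg _

lemma sum_fin_three_shift (f : Fin 3 → ℝ) (i : Fin 3) :
    ∑ j, f j = f i + f (i + 1) + f (i + 2) := by
  rw [← Equiv.sum_comp (Equiv.addLeft i) f, Fin.sum_univ_three]
  simp only [Equiv.coe_addLeft, add_zero]

lemma structureSum_swap (i j k : Fin 3) : structureSum B e i j k = structureSum B e j i k := by
  rw [structureSum, structureSum, Finset.sum_comm]
  refine Finset.sum_congr rfl fun α _ => Finset.sum_congr rfl fun β _ =>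
    Finset.sum_congr rfl fun γ _ => ?_
  rw [← lie_skew, map_neg, LinearMap.neg_apply, neg_sq]

lemma structureSum_self (hself : ∀ i α β c, B ⁅e ⟨i, α⟩, e ⟨i, β⟩⁆ (e c) = 0) (i k : Fin 3) :
    structureSum B e i i k = 0 := by
  simp only [structureSum, hself, ne_eq, OfNat.ofNat_ne_zero, not_false_eq_true, zero_pow,
    Finset.sum_const_zero]

lemma sum_sq_mul_eq_sum_structureSum (ψ : Fin 3 → Fin 3 → ℝ) (i : Fin 3) :
    ∑ α : Fin (d i), ∑ b, ∑ c, B ⁅e b, e ⟨i, α⟩⁆ (e c) ^ 2 * ψ b.1 c.1 =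
      ∑ j, ∑ k, structureSum B e j i k * ψ j k := by
  simp only [Fintype.sum_sigma, structureSum, Finset.sum_mul]
  rw [Finset.sum_comm]
  refine Finset.sum_congr rfl fun j _ => ?_
  exact (Finset.sum_comm' (by simp)).trans ((Finset.sum_congr rfl fun β _ =>
    Finset.sum_comm).trans Finset.sum_comm)

variable (hsymm : ∀ U V, B U V = B V U) (hlie : ∀ U V W, B ⁅U, V⁆ W = B U ⁅V, W⁆)
include hsymm hlie

lemma structureSum_rotate (i j k : Fin 3) : structureSum B e i j k = structureSum B e j k i := by
  rw [structureSum, structureSum, Finset.sum_comm]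
  refine Finset.sum_congr rfl fun α _ => ?_
  rw [Finset.sum_comm]
  refine Finset.sum_congr rfl fun β _ => Finset.sum_congr rfl fun γ _ => ?_
  rw [hlie, hsymm]

lemma structureSum_shift (i : Fin 3) :
    structureSum B e i (i + 1) (i + 2) = structureSum B e 0 1 2 := by
  have hrotate := structureSum_rotate (e := e) hsymm hlie
  fin_cases i
  · rfl
  · exact (hrotate 0 1 2).symm
  · exact hrotate 2 0 1

variable (hself : ∀ i α β c, B ⁅e ⟨i, α⟩, e ⟨i, β⟩⁆ (e c) = 0)
include hself

theorem sum_sq_mul_eq_structureSum_mul (ψ : Fin 3 → Fin 3 → ℝ) (i : Fin 3) :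
    ∑ α : Fin (d i), ∑ b, ∑ c, B ⁅e b, e ⟨i, α⟩⁆ (e c) ^ 2 * ψ b.1 c.1 =
      structureSum B e 0 1 2 * (ψ (i + 1) (i + 2) + ψ (i + 2) (i + 1)) := by
  have hrotate := structureSum_rotate (e := e) hsymm hlie
  have hleft : ∀ j k, structureSum B e j j k = 0 := structureSum_self hself
  have hright : ∀ j k, structureSum B e j k k = 0 := fun j k => by rw [hrotate, hleft]
  have houter : ∀ j k, structureSum B e j k j = 0 := fun j k => by rw [← hrotate, hleft]
  have h₁ : structureSum B e (i + 1) i (i + 2) = structureSum B e 0 1 2 := by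
    rw [structureSum_swap, structureSum_shift hsymm hlie]
  have h₂ : structureSum B e (i + 2) i (i + 1) = structureSum B e 0 1 2 := by
    rw [hrotate, structureSum_shift hsymm hlie]
  simp only [sum_sq_mul_eq_sum_structureSum, sum_fin_three_shift _ i, hleft, hright, houter, h₁, h₂,
    zero_mul, zero_add, add_zero]
  ring

end StructureConstants

section ModuleSums

/-- The Ricci curvature, in the direction of a module with constant `α`, in terms of the parameter
`a` of that module and of the parameters `b`, `c` of the two others. -/
def ricciCoeff (α a b c : ℝ) : ℝ := 1 / 2 + α * (a ^ 2 - b ^ 2 - c ^ 2) / (2 * (b * c))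

variable {L : Type*} [LieRing L] [LieAlgebra ℝ L] {d : Fin 3 → ℕ} {e : (Σ i, Fin (d i)) → L}
  (hself : ∀ i α β c, killingProduct L ⁅e ⟨i, α⟩, e ⟨i, β⟩⁆ (e c) = 0)
  (hkilling : ∀ a, ∑ b, (2 * normalSq (killingProduct L) e ⁅e b, e a⁆ +
    ∑ c, killingProduct L ⁅e b, e a⁆ (e c) ^ 2) = 1)
include hself hkilling

lemma sum_normalSq_add_structureSum (i : Fin 3) :
    ∑ α : Fin (d i), ∑ b, normalSq (killingProduct L) e ⁅e b, e ⟨i, α⟩⁆ +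
      structureSum (killingProduct L) e 0 1 2 = d i / 2 := by
  have hsum : ∑ α : Fin (d i), ∑ b, (2 * normalSq (killingProduct L) e ⁅e b, e ⟨i, α⟩⁆ +
      ∑ c, killingProduct L ⁅e b, e ⟨i, α⟩⁆ (e c) ^ 2 * 1) = d i := by
    simp only [mul_one, hkilling, Finset.sum_const, Finset.card_univ, Fintype.card_fin,
      nsmul_eq_mul]
  simp only [Finset.sum_add_distrib, ← Finset.mul_sum] at hsum
  have hstruct := sum_sq_mul_eq_structureSum_mul killingProduct_comm killingProduct_lie hself
    (fun _ _ => 1) i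
  linarith

lemma structureSum_le (hpos : ∀ U : L, U ≠ 0 → 0 < killingProduct L U U)
    (horth : ∀ a b, killingProduct L (e a) (e b) = if a = b then 1 else 0) (i : Fin 3) :
    structureSum (killingProduct L) e 0 1 2 ≤ d i / 2 := by
  rw [← sum_normalSq_add_structureSum hself hkilling i]
  exact le_add_of_nonneg_left (Finset.sum_nonneg fun _ _ => Finset.sum_nonneg fun _ _ =>
    normalSq_nonneg hpos horth _)

theorem sum_ricci_eq {x : Fin 3 → ℝ} (hx : ∀ i, 0 < x i) {α : ℝ} {i : Fin 3}
    (hα : structureSum (killingProduct L) e 0 1 2 = α * d i) :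
    ∑ β : Fin (d i), ∑ b, (normalSq (killingProduct L) e ⁅e b, e ⟨i, β⟩⁆ +
        (∑ c, killingProduct L ⁅e b, e ⟨i, β⟩⁆ (e c) ^ 2 * ((x i + x b.1) / 2 - 3 / 4 * x c.1 +
          (x i - x b.1) ^ 2 / (4 * x c.1))) / x b.1) =
      d i * ricciCoeff α (x i) (x (i + 1)) (x (i + 2)) := by
  have hnormal := sum_normalSq_add_structureSum hself hkilling i
  have hstruct := sum_sq_mul_eq_structureSum_mul killingProduct_comm killingProduct_lie hself
    (fun j k => ((x i + x j) / 2 - 3 / 4 * x k + (x i - x j) ^ 2 / (4 * x k)) / x j) i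
  simp only [mul_div_assoc, Finset.sum_add_distrib, Finset.sum_div] at hstruct ⊢
  have h₁ := (hx (i + 1)).ne'
  have h₂ := (hx (i + 2)).ne'
  rw [hstruct, eq_sub_of_add_eq hnormal, hα, ricciCoeff]
  field_simp
  ring

end ModuleSums

section Evolution

-- Gronwall with an integrating factor: `w * exp (-∫ b)` is monotone.
lemma pos_of_mul_le_deriv {w w' b : ℝ → ℝ} {τ : ℝ} (hτ : 0 ≤ τ)
    (hw : ∀ t ∈ Icc 0 τ, HasDerivWithinAt w (w' t) (Icc 0 τ) t)
    (hw' : ∀ t ∈ Icc 0 τ, w t * b t ≤ w' t) (hb : ContinuousOn b (Icc 0 τ)) (h0 : 0 < w 0) :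
    0 < w τ := by
  set b' : ℝ → ℝ := IccExtend hτ ((Icc 0 τ).domRestrict b)
  have hcont : Continuous b' := hb.domRestrict.Icc_extend'
  have heq : ∀ t ∈ Icc 0 τ, b' t = b t := fun t ht => IccExtend_of_mem hτ _ ht
  set E : ℝ → ℝ := fun t => Real.exp (-∫ u in (0 : ℝ)..t, b' u)
  have hderivE : ∀ t, HasDerivAt E (E t * -b' t) t := fun t =>
    (hcont.integral_hasStrictDerivAt 0 t).hasDerivAt.neg.exp
  have hderiv : ∀ t ∈ Icc 0 τ, HasDerivWithinAt (w * E) (w' t * E t + w t * (E t * -b' t))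
      (Icc 0 τ) t := fun t ht => (hw t ht).mul (hderivE t).hasDerivWithinAt
  have hmono : MonotoneOn (w * E) (Icc 0 τ) := by
    refine monotoneOn_of_hasDerivWithinAt_nonneg (convex_Icc 0 τ)
      (fun t ht => (hderiv t ht).continuousWithinAt)
      (fun t ht => (hderiv t (interior_subset ht)).mono interior_subset) fun t ht => ?_
    have hfactor : w' t * E t + w t * (E t * -b' t) = (w' t - w t * b t) * E t := by
      rw [heq t (interior_subset ht)]
      ring
    rw [hfactor]
    exact mul_nonneg (sub_nonneg.2 (hw' t (interior_subset ht))) (Real.exp_pos _).le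
  have hle := hmono ⟨le_rfl, hτ⟩ ⟨hτ, le_rfl⟩ hτ
  have hpos : 0 < w τ * E τ := (mul_pos h0 (Real.exp_pos _)).trans_le hle
  exact (mul_pos_iff_of_pos_right (Real.exp_pos _)).1 hpos

lemma ricciCoeff_comm (α a b c : ℝ) : ricciCoeff α a b c = ricciCoeff α a c b := by
  rw [ricciCoeff, ricciCoeff, mul_comm b c, sub_right_comm]

lemma ricciCoeff_pos {α a b c : ℝ} (hα : 0 < α) (hα' : α ≤ 1 / 2) (hb : 0 < b) (hc : 0 < c)
    (hbac : b < c + a) (hcab : c < b + a) : 0 < ricciCoeff α a b c := by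
  have hfactor : ricciCoeff α a b c =
      (1 / 2 - α) + α * ((a - (b - c)) * (a + (b - c))) / (2 * (b * c)) := by
    rw [ricciCoeff]
    field_simp
    ring
  have hprod : 0 < (a - (b - c)) * (a + (b - c)) := mul_pos (by linarith) (by linarith)
  rw [hfactor]
  exact add_pos_of_nonneg_of_pos (sub_nonneg.2 hα') (by positivity)

/-- The growth rate of `(a + b - c) / c` under the normalized Ricci flow, up to the term
`(2 * (α + β + γ) - 1) / c`. -/
def triangleRate (α β γ a b c : ℝ) : ℝ :=
  2 * ricciCoeff γ c a b / c - (α * (a - b + c) / (b * c) + β * (b - a + c) / (a * c) +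
    γ * (a + b + c) / (a * b))

lemma triangle_deriv_eq {a b c : ℝ} (ha : a ≠ 0) (hb : b ≠ 0) (hc : c ≠ 0) (α β γ s : ℝ) :
    ((-2 * ricciCoeff α a b c + 2 * a * s + (-2 * ricciCoeff β b c a + 2 * b * s) -
        (-2 * ricciCoeff γ c a b + 2 * c * s)) * c -
      (a + b - c) * (-2 * ricciCoeff γ c a b + 2 * c * s)) / c ^ 2 =
    (a + b - c) / c * triangleRate α β γ a b c + (2 * (α + β + γ) - 1) / c := by
  have hsum : ricciCoeff α a b c + ricciCoeff β b c a - ricciCoeff γ c a b =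
      1 / 2 - (α + β + γ) + (a + b - c) / 2 * (α * (a - b + c) / (b * c) +
        β * (b - a + c) / (a * c) + γ * (a + b + c) / (a * b)) := by
    simp only [ricciCoeff]
    field_simp
    ring
  rw [triangleRate]
  generalize α * (a - b + c) / (b * c) + β * (b - a + c) / (a * c) + γ * (a + b + c) / (a * b) = E
    at hsum ⊢
  field_simp
  linear_combination -2 * c * hsum

lemma continuousOn_triangleRate {a b c : ℝ → ℝ} {I : Set ℝ} (hca : ContinuousOn a I)
    (hcb : ContinuousOn b I) (hcc : ContinuousOn c I) (ha : ∀ t ∈ I, a t ≠ 0)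
    (hb : ∀ t ∈ I, b t ≠ 0) (hc : ∀ t ∈ I, c t ≠ 0) (α β γ : ℝ) :
    ContinuousOn (fun t => triangleRate α β γ (a t) (b t) (c t)) I := by
  have hab : ∀ t ∈ I, a t * b t ≠ 0 := fun t ht => mul_ne_zero (ha t ht) (hb t ht)
  have hac : ∀ t ∈ I, a t * c t ≠ 0 := fun t ht => mul_ne_zero (ha t ht) (hc t ht)
  have hbc : ∀ t ∈ I, b t * c t ≠ 0 := fun t ht => mul_ne_zero (hb t ht) (hc t ht)
  have hab' : ∀ t ∈ I, 2 * (a t * b t) ≠ 0 := fun t ht => mul_ne_zero two_ne_zero (hab t ht)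
  unfold triangleRate ricciCoeff
  fun_prop (disch := assumption)

theorem triangle_of_flow {α β γ T : ℝ} (hαβγ : 1 / 2 ≤ α + β + γ) {a b c s : ℝ → ℝ}
    (ha : ∀ t ∈ Ico 0 T, 0 < a t) (hb : ∀ t ∈ Ico 0 T, 0 < b t) (hc : ∀ t ∈ Ico 0 T, 0 < c t)
    (hda : ∀ t ∈ Ico 0 T, HasDerivWithinAt a
      (-2 * ricciCoeff α (a t) (b t) (c t) + 2 * a t * s t) (Ico 0 T) t)
    (hdb : ∀ t ∈ Ico 0 T, HasDerivWithinAt b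
      (-2 * ricciCoeff β (b t) (c t) (a t) + 2 * b t * s t) (Ico 0 T) t)
    (hdc : ∀ t ∈ Ico 0 T, HasDerivWithinAt c
      (-2 * ricciCoeff γ (c t) (a t) (b t) + 2 * c t * s t) (Ico 0 T) t)
    (h0 : c 0 < a 0 + b 0) : ∀ t ∈ Ico 0 T, c t < a t + b t := by
  intro τ hτ
  have hsub : Icc 0 τ ⊆ Ico 0 T := Icc_subset_Ico_right hτ.2
  have hderiv : ∀ t ∈ Icc 0 τ, HasDerivWithinAt (fun t => (a t + b t - c t) / c t)
      ((a t + b t - c t) / c t * triangleRate α β γ (a t) (b t) (c t) +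
        (2 * (α + β + γ) - 1) / c t) (Icc 0 τ) t := by
    intro t ht
    have ht' := hsub ht
    rw [← triangle_deriv_eq (ha t ht').ne' (hb t ht').ne' (hc t ht').ne' α β γ (s t)]
    exact ((((hda t ht').add (hdb t ht')).sub (hdc t ht')).div (hdc t ht') (hc t ht').ne').mono hsub
  have hcont : ContinuousOn (fun t => triangleRate α β γ (a t) (b t) (c t)) (Icc 0 τ) :=
    (continuousOn_triangleRate (fun t ht => (hda t ht).continuousWithinAt)
      (fun t ht => (hdb t ht).continuousWithinAt) (fun t ht => (hdc t ht).continuousWithinAt)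
      (fun t ht => (ha t ht).ne') (fun t ht => (hb t ht).ne') (fun t ht => (hc t ht).ne')
      α β γ).mono hsub
  have hpos : 0 < (a τ + b τ - c τ) / c τ := by
    refine pos_of_mul_le_deriv (w := fun t => (a t + b t - c t) / c t) hτ.1 hderiv
      (fun t ht => le_add_of_nonneg_right ?_) hcont ?_
    · exact div_nonneg (by linarith) (hc t (hsub ht)).le
    · exact div_pos (sub_pos.2 h0) (hc 0 (hsub ⟨le_rfl, hτ.1⟩))
  exact sub_pos.1 ((div_pos_iff_of_pos_right (hc τ hτ)).1 hpos)

end Evolution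

section Homogeneous

variable {m n : ℕ} {G : Type*} [TopologicalSpace G] [ChartedSpace (EuclideanSpace ℝ (Fin m)) G]
  [Group G] {H : Subgroup G} [ChartedSpace (EuclideanSpace ℝ (Fin n)) (G ⧸ H)]

/-- The action of `G` on `G ⧸ H`, twisted by the conjugation by `a`. The twist makes the
fundamental fields at `a • 1` the translates by `a` of those at the base point. -/
def twistedSMul (H : Subgroup G) (a b : G) (y : G ⧸ H) : G ⧸ H := (a * b * a⁻¹) • y

omit [TopologicalSpace G] [ChartedSpace (EuclideanSpace ℝ (Fin m)) G]
  [ChartedSpace (EuclideanSpace ℝ (Fin n)) (G ⧸ H)] in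
lemma twistedSMul_smul_one (a b : G) :
    twistedSMul H a b (a • ((1 : G) : G ⧸ H)) = a • (b : G ⧸ H) := by
  rw [twistedSMul, smul_smul, inv_mul_cancel_right, mul_smul, MulAction.Quotient.smul_coe,
    smul_eq_mul, mul_one]

namespace IsHomogeneousManifold

lemma isSmoothAction [LieGroup (𝓡 m) ∞ G] (h : IsHomogeneousManifold m n H) (a : G) :
    IsSmoothAction m n (twistedSMul H a) where
  contMDiff := by
    have := h.smooth_smul
    have hconj : ContMDiff ((𝓡 m).prod (𝓡 n)) ((𝓡 m).prod (𝓡 n)) ∞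
        (fun q : G × (G ⧸ H) => (a * q.1 * a⁻¹, q.2)) :=
      ((contMDiff_const.mul contMDiff_fst).mul contMDiff_const).prodMk contMDiff_snd
    exact this.contMDiff_smul.comp hconj
  mul b c y := by
    rw [twistedSMul, twistedSMul, twistedSMul, smul_smul]
    congr 1
    group
  one y := by rw [twistedSMul, mul_one, mul_inv_cancel, one_smul]

lemma mdifferentiable_smul (h : IsHomogeneousManifold m n H) (a : G) :
    MDifferentiable (𝓡 n) (𝓡 n) (fun y : G ⧸ H => a • y) := by
  have := h.smooth_smul
  have hsmooth : ContMDiff (𝓡 n) (𝓡 n) ∞ (fun y : G ⧸ H => a • y) :=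
    this.contMDiff_smul.comp (contMDiff_const.prodMk contMDiff_id)
  exact hsmooth.mdifferentiable (by simp)

lemma fundField_twistedSMul (h : IsHomogeneousManifold m n H) (a : G)
    (X : GroupLieAlgebra (𝓡 m) G) :
    fundField (n := n) (twistedSMul H a) X (a • ((1 : G) : G ⧸ H)) =
      mderiv (𝓡 n) (𝓡 n) (fun y : G ⧸ H => a • y) ((1 : G) : G ⧸ H) (dproj n H X) := by
  simp only [fundField, twistedSMul_smul_one]
  exact mderiv_comp (I' := 𝓡 n) 1 (h.mdifferentiable_smul a _)
    (h.smooth_mk.mdifferentiable (by simp) _) X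

lemma surjective_mderiv_smul (h : IsHomogeneousManifold m n H) (a : G) :
    Function.Surjective
      (mderiv (𝓡 n) (𝓡 n) (fun y : G ⧸ H => a • y) ((1 : G) : G ⧸ H)) := by
  intro v
  have hchain := mderiv_comp (I' := 𝓡 n) (a • ((1 : G) : G ⧸ H)) (h.mdifferentiable_smul a _)
    (h.mdifferentiable_smul a⁻¹ _) v
  simp only [smul_inv_smul, inv_smul_smul] at hchain
  rw [mderiv_id] at hchain
  exact ⟨_, hchain.symm⟩

lemma surjective_fundField (h : IsHomogeneousManifold m n H) (a : G)
    (v : TangentSpace (𝓡 n) (a • ((1 : G) : G ⧸ H))) :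
    ∃ X : GroupLieAlgebra (𝓡 m) G,
      fundField (n := n) (twistedSMul H a) X (a • ((1 : G) : G ⧸ H)) = v := by
  obtain ⟨w, rfl⟩ := h.surjective_mderiv_smul a v
  obtain ⟨X, rfl⟩ := h.submersion 1 w
  exact ⟨X, h.fundField_twistedSMul a X⟩

end IsHomogeneousManifold

variable [LieGroup (𝓡 m) ∞ G]

instance : FiniteDimensional ℝ (GroupLieAlgebra (𝓡 m) G) :=
  inferInstanceAs (FiniteDimensional ℝ (EuclideanSpace ℝ (Fin m)))

variable {p : Fin 3 → Submodule ℝ (GroupLieAlgebra (𝓡 m) G)}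

lemma IsInvariantMetric.isKillingFamily [IsManifold (𝓡 n) ∞ (G ⧸ H)] {x : Fin 3 → ℝ}
    {g : Metric n (G ⧸ H)} (hg : IsInvariantMetric p x g) (h : IsHomogeneousManifold m n H)
    (a : G) : IsKillingFamily g (fundField (m := m) (twistedSMul H a)) :=
  (h.isSmoothAction a).isKillingFamily g fun b y v w => hg.invariant (a * b * a⁻¹) y v w

/-- The infinitesimal part of a generalized Wallach space: the orthogonal splitting of the
complement of the isotropy algebra, and the bracket relations. -/
structure IsWallachDecomposition (n : ℕ) (H : Subgroup G)
    [ChartedSpace (EuclideanSpace ℝ (Fin n)) (G ⧸ H)]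
    (p : Fin 3 → Submodule ℝ (GroupLieAlgebra (𝓡 m) G)) : Prop where
  homogeneous : IsHomogeneousManifold m n H
  pos : ∀ X : GroupLieAlgebra (𝓡 m) G, X ≠ 0 → 0 < negKilling X X
  sum_eq : ∀ X : GroupLieAlgebra (𝓡 m) G,
    X ∈ ⨆ i, p i ↔ ∀ Y ∈ isotropyAlgebra n H, negKilling X Y = 0
  orthogonal : ∀ i j, i ≠ j → ∀ X ∈ p i, ∀ Y ∈ p j, negKilling X Y = 0
  bracket_mem : ∀ i, ∀ X ∈ p i, ∀ Y ∈ p i, ⁅X, Y⁆ ∈ isotropyAlgebra n H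

lemma IsGeneralizedWallach.isWallachDecomposition (h : IsGeneralizedWallach n H p) :
    IsWallachDecomposition n H p where
  homogeneous := h.homogeneous
  pos := h.pos
  sum_eq := h.sum_eq
  orthogonal := h.orthogonal
  bracket_mem := h.bracket_mem

variable {d : Fin 3 → ℕ}

/-- The vectors of given bases of the three modules, as a single family in the Lie algebra. -/
def moduleFrame (e : ∀ i, Module.Basis (Fin (d i)) ℝ (p i)) (c : Σ i, Fin (d i)) :
    GroupLieAlgebra (𝓡 m) G := e c.1 c.2

namespace IsWallachDecomposition

variable (hW : IsWallachDecomposition n H p) {e : ∀ i, Module.Basis (Fin (d i)) ℝ (p i)}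
include hW

lemma nondegenerate : (killingProduct (GroupLieAlgebra (𝓡 m) G)).Nondegenerate := by
  have hdef : ∀ X, killingProduct (GroupLieAlgebra (𝓡 m) G) X X = 0 → X = 0 := fun X hX => by
    by_contra hne
    exact (hW.pos X hne).ne' hX
  exact ⟨fun X hX => hdef X (hX X), fun X hX => hdef X (hX X)⟩

lemma lie_moduleFrame_self (i : Fin 3) (α β : Fin (d i)) (c : Σ i, Fin (d i)) :
    killingProduct (GroupLieAlgebra (𝓡 m) G) ⁅moduleFrame e ⟨i, α⟩, moduleFrame e ⟨i, β⟩⁆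
      (moduleFrame e c) = 0 := by
  rw [killingProduct_comm]
  exact (hW.sum_eq _).1 (Submodule.mem_iSup_of_mem c.1 (e c.1 c.2).2) _
    (hW.bracket_mem i _ (e i α).2 _ (e i β).2)

lemma mem_isotropyAlgebra {Z : GroupLieAlgebra (𝓡 m) G}
    (hZ : ∀ c, killingProduct _ Z (moduleFrame e c) = 0) : Z ∈ isotropyAlgebra n H := by
  have hrefl : (killingProduct (GroupLieAlgebra (𝓡 m) G)).IsRefl := fun X Y hXY => by
    rw [killingProduct_comm, hXY]
  have hmodule : ∀ i, p i ≤ LinearMap.ker (killingProduct _ Z) := fun i X hX => by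
    have hzero : killingProduct _ Z ∘ₗ (p i).subtype = 0 := (e i).ext fun α => hZ ⟨i, α⟩
    exact LinearMap.congr_fun hzero ⟨X, hX⟩
  rw [← LinearMap.BilinForm.orthogonal_orthogonal hW.nondegenerate hrefl (isotropyAlgebra n H)]
  intro X hX
  have hsup : X ∈ ⨆ i, p i :=
    (hW.sum_eq X).2 fun Y hY => (killingProduct_comm X Y).trans (hX Y hY)
  exact (killingProduct_comm X Z).trans (iSup_le hmodule hsup)

variable (he : AreOrthonormal e)
include he

lemma orthonormal_moduleFrame (a b : Σ i, Fin (d i)) :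
    killingProduct _ (moduleFrame e a) (moduleFrame e b) = if a = b then 1 else 0 := by
  obtain ⟨i, α⟩ := a
  obtain ⟨j, β⟩ := b
  by_cases hij : i = j
  · subst hij
    refine (he i α β).trans ?_
    simp only [Sigma.mk.injEq, heq_eq_eq, true_and]
  · rw [if_neg fun h => hij (congrArg Sigma.fst h)]
    exact hW.orthogonal i j hij _ (e i α).2 _ (e j β).2

lemma dproj_frameProj (U : GroupLieAlgebra (𝓡 m) G) :
    dproj n H (frameProj (killingProduct _) (moduleFrame e) U) = dproj n H U := by
  have hker : dproj n H (U - frameProj (killingProduct _) (moduleFrame e) U) = 0 :=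
    hW.mem_isotropyAlgebra (apply_sub_frameProj (hW.orthonormal_moduleFrame he) U)
  rw [map_sub, sub_eq_zero] at hker
  exact hker.symm

variable [IsManifold (𝓡 n) ∞ (G ⧸ H)] {x : Fin 3 → ℝ} {g : Metric n (G ⧸ H)}
  (hg : IsInvariantMetric p x g)
include hg

lemma inner_dproj_moduleFrame (b c : Σ i, Fin (d i)) :
    g.inner ((1 : G) : G ⧸ H) (dproj n H (moduleFrame e b)) (dproj n H (moduleFrame e c)) =
      if b = c then x b.1 else 0 := by
  have horth : negKilling (moduleFrame e b) (moduleFrame e c) = if b = c then 1 else 0 :=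
    hW.orthonormal_moduleFrame he b c
  refine (hg.diagonal b.1 c.1 _ (e b.1 b.2).2 _ (e c.1 c.2).2).trans ?_
  change (if b.1 = c.1 then x b.1 * negKilling (moduleFrame e b) (moduleFrame e c) else 0) = _
  rw [horth, mul_ite, mul_one, mul_zero, ← ite_and]
  exact if_congr ⟨And.right, fun h => ⟨congrArg Sigma.fst h, h⟩⟩ rfl rfl

lemma inner_dproj (U V : GroupLieAlgebra (𝓡 m) G) :
    g.inner ((1 : G) : G ⧸ H) (dproj n H U) (dproj n H V) =
      ∑ c, x c.1 *
        (killingProduct _ U (moduleFrame e c) * killingProduct _ V (moduleFrame e c)) := by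
  rw [← hW.dproj_frameProj he U, ← hW.dproj_frameProj he V]
  exact apply_frameProj_frameProj_of_orthogonal
    (q := (metricForm g ((1 : G) : G ⧸ H)).compl₁₂ (dproj n H).toLinearMap
      (dproj n H).toLinearMap) (x := fun c : Σ i, Fin (d i) => x c.1)
    (hW.inner_dproj_moduleFrame he hg) U V

theorem isDiagonalAt (a : G) :
    IsDiagonalAt g (fundField (m := m) (twistedSMul H a)) (a • ((1 : G) : G ⧸ H))
      (killingProduct _) (moduleFrame e) (fun c => x c.1) where
  symm := killingProduct_comm
  lie := killingProduct_lie
  orthonormal := hW.orthonormal_moduleFrame he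
  pos c := hg.pos c.1
  inner U V := by
    rw [hW.homogeneous.fundField_twistedSMul, hW.homogeneous.fundField_twistedSMul]
    exact (hg.invariant a _ _ _).trans (hW.inner_dproj he hg U V)
  surjective := hW.homogeneous.surjective_fundField a

end IsWallachDecomposition

end Homogeneous

section DiagonalFlow

variable {n : ℕ} {M : Type*} [TopologicalSpace M] [ChartedSpace (EuclideanSpace ℝ (Fin n)) M]
  [IsManifold (𝓡 n) ∞ M] {L : Type*} [LieRing L] [LieAlgebra ℝ L]
  {J : Type*} [Fintype J] [DecidableEq J]
  {g : ℝ → Metric n M} {K : L → ∀ y : M, TangentSpace (𝓡 n) y} {y : M}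
  {B : LinearMap.BilinForm ℝ L} {e : J → L} {x : ℝ → J → ℝ} {I : Set ℝ}
  (hD : ∀ s ∈ I, IsDiagonalAt (g s) K y B e (x s)) {t : ℝ} (ht : t ∈ I)
  {q : TangentSpace (𝓡 n) y → TangentSpace (𝓡 n) y → ℝ} {σ : ℝ}
  (hder : ∀ v w : TangentSpace (𝓡 n) y, HasDerivWithinAt (fun s => (g s).inner y v w)
    (-2 * q v w + 2 * (g t).inner y v w * σ) I t)
include hD ht hder

lemma hasDerivWithinAt_of_isDiagonalAt (b : J) : HasDerivWithinAt (fun s => x s b)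
    (-2 * q (K (e b) y) (K (e b) y) + 2 * x t b * σ) I t := by
  have hinner : ∀ s ∈ I, (g s).inner y (K (e b) y) (K (e b) y) = x s b := fun s hs => by
    rw [(hD s hs).inner_basis, if_pos rfl]
  have hbb := hder (K (e b) y) (K (e b) y)
  rw [hinner t ht] at hbb
  exact hbb.congr (fun s hs => (hinner s hs).symm) (hinner t ht).symm

lemma apply_eq_zero_of_isDiagonalAt (huniq : UniqueDiffWithinAt ℝ I t) {b c : J} (hbc : b ≠ c) :
    q (K (e b) y) (K (e c) y) = 0 := by
  have hinner : ∀ s ∈ I, (g s).inner y (K (e b) y) (K (e c) y) = 0 := fun s hs => by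
    rw [(hD s hs).inner_basis, if_neg hbc]
  have hconst := (hasDerivWithinAt_const t I (0 : ℝ)).congr hinner (hinner t ht)
  have hzero := huniq.eq_deriv _ (hder (K (e b) y) (K (e c) y)) hconst
  rw [hinner t ht, mul_zero, zero_mul, add_zero] at hzero
  exact (mul_eq_zero.1 hzero).resolve_left (by norm_num)

lemma apply_self_eq_of_isDiagonalAt (huniq : UniqueDiffWithinAt ℝ I t) {b c : J}
    (hbc : ∀ s, x s b = x s c) :
    q (K (e b) y) (K (e b) y) = q (K (e c) y) (K (e c) y) := by
  have hb := hasDerivWithinAt_of_isDiagonalAt hD ht hder b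
  simp only [hbc] at hb
  linarith [huniq.eq_deriv _ hb (hasDerivWithinAt_of_isDiagonalAt hD ht hder c)]

end DiagonalFlow

lemma IsRicciTensor.exists_bilinForm {n : ℕ} {M : Type*} [TopologicalSpace M]
    [ChartedSpace (EuclideanSpace ℝ (Fin n)) M] [IsManifold (𝓡 n) ∞ M] {g : Metric n M}
    {Ric : ∀ y : M, TangentSpace (𝓡 n) y → TangentSpace (𝓡 n) y → ℝ}
    (hRic : IsRicciTensor g Ric) (y : M) :
    ∃ q : TangentSpace (𝓡 n) y →ₗ[ℝ] TangentSpace (𝓡 n) y →ₗ[ℝ] ℝ, ∀ v w, q v w = Ric y v w := by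
  obtain ⟨cov, -, R, -, htrace⟩ := hRic
  exact ⟨LinearMap.llcomp ℝ _ _ _ (LinearMap.trace ℝ (TangentSpace (𝓡 n) y)) ∘ₗ
    LinearMap.lflip.toLinearMap ∘ₗ (R y).flip, fun v w => (htrace y v w).symm⟩

section Flow

variable {m : ℕ} {G : Type*} [TopologicalSpace G] [ChartedSpace (EuclideanSpace ℝ (Fin m)) G]
  [Group G] [LieGroup (𝓡 m) ∞ G]
  {p : Fin 3 → Submodule ℝ (GroupLieAlgebra (𝓡 m) G)} {d : Fin 3 → ℕ}
  {e : ∀ i, Module.Basis (Fin (d i)) ℝ (p i)}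

/-- The value `Ric(X, X)`, for `X` in the `i`-th module with `⟨X, X⟩ = 1`, of the Ricci tensor of
the invariant metric with parameters `x`. The addition of indices is modulo `3`. -/
def moduleRicci (e : ∀ i, Module.Basis (Fin (d i)) ℝ (p i)) (x : Fin 3 → ℝ) (i : Fin 3) : ℝ :=
  ricciCoeff (wallachConstant e i) (x i) (x (i + 1)) (x (i + 2))

lemma moduleRicci_eq_ricciCoeff (x : Fin 3 → ℝ) {i j k : Fin 3} (hij : i ≠ j) (hjk : j ≠ k)
    (hik : i ≠ k) : moduleRicci e x i = ricciCoeff (wallachConstant e i) (x i) (x j) (x k) := by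
  have hcases : (j = i + 1 ∧ k = i + 2) ∨ (j = i + 2 ∧ k = i + 1) := by
    revert i j k
    decide
  obtain ⟨rfl, rfl⟩ | ⟨rfl, rfl⟩ := hcases
  · rfl
  · exact ricciCoeff_comm ..

lemma structureSum_moduleFrame_pos (hsum : 1 / 2 ≤ ∑ i, wallachConstant e i) :
    0 < structureSum (killingProduct (GroupLieAlgebra (𝓡 m) G)) (moduleFrame e) 0 1 2 := by
  refine (structureSum_nonneg _ _ _).lt_of_ne' fun hzero => ?_
  have hconst : ∀ i, wallachConstant e i = 0 := fun i => by
    change structureSum (killingProduct _) (moduleFrame e) 0 1 2 / d i = 0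
    rw [hzero, zero_div]
  norm_num [hconst] at hsum

namespace IsWallachDecomposition

variable {n : ℕ} {H : Subgroup G} [ChartedSpace (EuclideanSpace ℝ (Fin n)) (G ⧸ H)]
  [IsManifold (𝓡 n) ∞ (G ⧸ H)] (hW : IsWallachDecomposition n H p) (he : AreOrthonormal e)
include hW he

section Metric

variable {x : Fin 3 → ℝ} {g : Metric n (G ⧸ H)} (hg : IsInvariantMetric p x g)
include hg

lemma sum_normalSq_lie_moduleFrame (a : Σ i, Fin (d i)) :
    ∑ b, (2 * normalSq (killingProduct _) (moduleFrame e) ⁅moduleFrame e b, moduleFrame e a⁆ +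
      ∑ c, killingProduct _ ⁅moduleFrame e b, moduleFrame e a⁆ (moduleFrame e c) ^ 2) = 1 :=
  sum_normalSq_lie hW.pos (hW.orthonormal_moduleFrame he)
    (fun _ _ hU hV => (hW.isDiagonalAt he hg 1).lie_subalgebra
      (hg.isKillingFamily hW.homogeneous 1) hU hV) a

lemma structureSum_moduleFrame_le (i : Fin 3) :
    structureSum (killingProduct _) (moduleFrame e) 0 1 2 ≤ d i / 2 :=
  structureSum_le hW.lie_moduleFrame_self (hW.sum_normalSq_lie_moduleFrame he hg) hW.pos
    (hW.orthonormal_moduleFrame he) i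

lemma wallachConstant_le_half (i : Fin 3) : wallachConstant e i ≤ 1 / 2 :=
  div_le_of_le_mul₀ (Nat.cast_nonneg _) (by norm_num)
    ((hW.structureSum_moduleFrame_le he hg i).trans_eq (by ring))

lemma structureSum_moduleFrame_eq (i : Fin 3) :
    structureSum (killingProduct _) (moduleFrame e) 0 1 2 = wallachConstant e i * d i := by
  refine (div_mul_cancel_of_imp fun hd => ?_).symm
  have hle := hW.structureSum_moduleFrame_le he hg i
  rw [hd, zero_div] at hle
  exact le_antisymm hle (structureSum_nonneg _ _ _)

section Constants

variable (hsum : 1 / 2 ≤ ∑ i, wallachConstant e i)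
include hsum

lemma dim_pos (i : Fin 3) : 0 < d i := by
  have hle := hW.structureSum_moduleFrame_le he hg i
  have hpos := structureSum_moduleFrame_pos hsum
  exact Nat.cast_pos.1 (show (0 : ℝ) < d i by linarith)

lemma wallachConstant_pos (i : Fin 3) : 0 < wallachConstant e i :=
  div_pos (structureSum_moduleFrame_pos hsum) (Nat.cast_pos.2 (hW.dim_pos he hg hsum i))

end Constants

theorem sum_ricci_moduleFrame
    {Ric : ∀ y : G ⧸ H, TangentSpace (𝓡 n) y → TangentSpace (𝓡 n) y → ℝ}
    (hRic : IsRicciTensor g Ric) (a : G) (i : Fin 3) :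
    ∑ α : Fin (d i), Ric (a • ((1 : G) : G ⧸ H))
        (fundField (m := m) (twistedSMul H a) (moduleFrame e ⟨i, α⟩) _)
        (fundField (m := m) (twistedSMul H a) (moduleFrame e ⟨i, α⟩) _) =
      d i * moduleRicci e x i := by
  obtain ⟨cov, hcov, R, hR, hRic⟩ := hRic
  have htrace := (hW.isDiagonalAt he hg a).trace_curvature
    (hg.isKillingFamily hW.homogeneous a) hcov hR
  simp only [hRic]
  exact (Finset.sum_congr rfl fun α _ => htrace ⟨i, α⟩).trans
    (sum_ricci_eq hW.lie_moduleFrame_self (hW.sum_normalSq_lie_moduleFrame he hg) hg.pos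
      (hW.structureSum_moduleFrame_eq he hg i))

end Metric

variable {T : ℝ} {x : ℝ → Fin 3 → ℝ} {g : ℝ → Metric n (G ⧸ H)}
  (hg : ∀ t ∈ Ico (0 : ℝ) T, IsInvariantMetric p (x t) (g t))
include hg

section Time

variable {t : ℝ} (ht : t ∈ Ico 0 T)
  {Ric : ∀ y : G ⧸ H, TangentSpace (𝓡 n) y → TangentSpace (𝓡 n) y → ℝ} {S : G ⧸ H → ℝ}
  (hRic : IsRicciTensor (g t) Ric)
  (hder : ∀ (y : G ⧸ H) (v w : TangentSpace (𝓡 n) y),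
    HasDerivWithinAt (fun s => (g s).inner y v w)
      (-2 * Ric y v w + 2 * (g t).inner y v w * (S y / n)) (Ico 0 T) t)
include ht hRic hder

theorem ricci_moduleFrame (a : G) (b c : Σ i, Fin (d i)) :
    Ric (a • ((1 : G) : G ⧸ H))
        (fundField (m := m) (twistedSMul H a) (moduleFrame e b) _)
        (fundField (m := m) (twistedSMul H a) (moduleFrame e c) _) =
      if b = c then moduleRicci e (x t) b.1 else 0 := by
  have hD := fun s hs => hW.isDiagonalAt he (hg s hs) a
  have huniq : UniqueDiffWithinAt ℝ (Ico 0 T) t := uniqueDiffOn_Ico 0 T t ht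
  split_ifs with hbc
  · subst hbc
    obtain ⟨i, α⟩ := b
    have hsum := hW.sum_ricci_moduleFrame he (hg t ht) hRic a i
    rw [Finset.sum_congr rfl fun β _ =>
        apply_self_eq_of_isDiagonalAt hD ht (hder _) huniq (b := ⟨i, β⟩) (c := ⟨i, α⟩)
          fun _ => rfl,
      Finset.sum_const, Finset.card_univ, Fintype.card_fin, nsmul_eq_mul] at hsum
    exact mul_left_cancel₀ (Nat.cast_ne_zero.2 α.pos.ne') hsum
  · exact apply_eq_zero_of_isDiagonalAt hD ht (hder _) huniq hbc

theorem hasDerivWithinAt_moduleRicci (hsum : 1 / 2 ≤ ∑ i, wallachConstant e i) (i : Fin 3) :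
    HasDerivWithinAt (fun s => x s i)
      (-2 * moduleRicci e (x t) i + 2 * x t i * (S ((1 : G) • ((1 : G) : G ⧸ H)) / n))
      (Ico 0 T) t := by
  have hderiv := hasDerivWithinAt_of_isDiagonalAt
    (fun s hs => hW.isDiagonalAt he (hg s hs) 1) ht (hder _)
    ⟨i, ⟨0, hW.dim_pos he (hg t ht) hsum i⟩⟩
  rwa [hW.ricci_moduleFrame he hg ht hRic hder, if_pos rfl] at hderiv

theorem ricci_pos (hpos : ∀ i, 0 < moduleRicci e (x t) i) (y : G ⧸ H) {v : TangentSpace (𝓡 n) y}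
    (hv : v ≠ 0) : 0 < Ric y v v := by
  obtain ⟨a, rfl⟩ := MulAction.exists_smul_eq G ((1 : G) : G ⧸ H) y
  obtain ⟨b, hb⟩ := (hW.isDiagonalAt he (hg t ht) a).exists_basis
    ((hg t ht).isKillingFamily hW.homogeneous a)
  obtain ⟨q, hq⟩ := hRic.exists_bilinForm (a • ((1 : G) : G ⧸ H))
  have hdiag : ∀ c c', q (b c) (b c') = if c = c' then moduleRicci e (x t) c.1 else 0 :=
    fun c c' => by rw [hb, hb, hq, hW.ricci_moduleFrame he hg ht hRic hder]
  rw [← hq]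
  exact pos_of_orthogonal b q hdiag (fun c => hpos c.1) hv

end Time

variable (hsum : 1 / 2 ≤ ∑ i, wallachConstant e i) (hflow : IsNormalizedRicciFlow T g)
  (h0 : ∀ i j k : Fin 3, i ≠ j → j ≠ k → i ≠ k → x 0 k < x 0 i + x 0 j)
include hsum hflow h0

theorem triangle_of_isNormalizedRicciFlow (i j k : Fin 3) (hij : i ≠ j) (hjk : j ≠ k)
    (hik : i ≠ k) : ∀ t ∈ Ico 0 T, x t k < x t i + x t j := by
  choose! Ric S hRic _ hder using hflow
  have hderiv : ∀ i j k : Fin 3, i ≠ j → j ≠ k → i ≠ k → ∀ t ∈ Ico 0 T,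
      HasDerivWithinAt (fun s => x s i)
        (-2 * ricciCoeff (wallachConstant e i) (x t i) (x t j) (x t k) +
          2 * x t i * (S t ((1 : G) • ((1 : G) : G ⧸ H)) / n)) (Ico 0 T) t :=
    fun i j k hij hjk hik t ht => by
      rw [← moduleRicci_eq_ricciCoeff (x t) hij hjk hik]
      exact hW.hasDerivWithinAt_moduleRicci he hg ht (hRic t ht) (hder t ht) hsum i
  have hconst : 1 / 2 ≤ wallachConstant e i + wallachConstant e j + wallachConstant e k := by
    have huniv : (Finset.univ : Finset (Fin 3)) = {i, j, k} := by
      revert i j k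
      decide
    rwa [huniv, Finset.sum_insert (by simp [hij, hik]), Finset.sum_pair hjk, ← add_assoc] at hsum
  exact triangle_of_flow hconst (fun t ht => (hg t ht).pos i) (fun t ht => (hg t ht).pos j)
    (fun t ht => (hg t ht).pos k) (hderiv i j k hij hjk hik)
    (hderiv j k i hjk hik.symm hij.symm) (hderiv k i j hik.symm hij hjk.symm)
    (h0 i j k hij hjk hik)

theorem moduleRicci_pos_of_isNormalizedRicciFlow {t : ℝ} (ht : t ∈ Ico 0 T) (i : Fin 3) :
    0 < moduleRicci e (x t) i := by
  have htriangle := hW.triangle_of_isNormalizedRicciFlow he hg hsum hflow h0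
  have h₁ : i + 1 ≠ i := by simp
  have h₂ : i + 2 ≠ i := by simp
  have h₁₂ : i + 1 ≠ i + 2 := by simp
  exact ricciCoeff_pos (hW.wallachConstant_pos he (hg t ht) hsum i)
    (hW.wallachConstant_le_half he (hg t ht) i) ((hg t ht).pos _) ((hg t ht).pos _)
    (htriangle _ _ _ h₂ h₁.symm h₁₂.symm t ht) (htriangle _ _ _ h₁ h₂.symm h₁₂ t ht)

end IsWallachDecomposition

end Flow

end Wallach

end

theorem theorem4_general {m n : ℕ} {G : Type*} [TopologicalSpace G]
    [ChartedSpace (EuclideanSpace ℝ (Fin m)) G] [Group G] [LieGroup (𝓡 m) ∞ G]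
    (H : Subgroup G)
    [ChartedSpace (EuclideanSpace ℝ (Fin n)) (G ⧸ H)] [IsManifold (𝓡 n) ∞ (G ⧸ H)]
    (p : Fin 3 → Submodule ℝ (GroupLieAlgebra (𝓡 m) G))
    (hW : Wallach.IsWallachDecomposition n H p)
    {d : Fin 3 → ℕ} (e : ∀ i, Module.Basis (Fin (d i)) ℝ (p i))
    (he : Wallach.AreOrthonormal e)
    (ha : 1 / 2 ≤ ∑ i, Wallach.wallachConstant e i)
    (T : ℝ) (x : ℝ → Fin 3 → ℝ) (g : ℝ → Wallach.Metric n (G ⧸ H))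
    (hg : ∀ t ∈ Ico (0 : ℝ) T, Wallach.IsInvariantMetric p (x t) (g t))
    (hflow : Wallach.IsNormalizedRicciFlow T g)
    (h0 : ∀ i j k : Fin 3, i ≠ j → j ≠ k → i ≠ k → x 0 k < x 0 i + x 0 j) :
    ∀ t ∈ Ico (0 : ℝ) T, Wallach.HasPositiveRicci (g t) := by
  intro t ht
  have hmodule := hW.moduleRicci_pos_of_isNormalizedRicciFlow he hg ha hflow h0 ht
  obtain ⟨Ric, S, hRic, -, hder⟩ := hflow t ht
  exact ⟨Ric, hRic, fun y v hv => hW.ricci_pos he hg ht hRic hder hmodule y hv⟩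

theorem theorem4 {m n : ℕ} {G : Type*} [TopologicalSpace G] [T2Space G] [CompactSpace G]
    [ChartedSpace (EuclideanSpace ℝ (Fin m)) G] [Group G] [LieGroup (𝓡 m) ∞ G]
    (H : Subgroup G)
    [ChartedSpace (EuclideanSpace ℝ (Fin n)) (G ⧸ H)] [IsManifold (𝓡 n) ∞ (G ⧸ H)]
    (p : Fin 3 → Submodule ℝ (GroupLieAlgebra (𝓡 m) G))
    (hW : Wallach.IsGeneralizedWallach n H p)
    {d : Fin 3 → ℕ} (e : ∀ i, Module.Basis (Fin (d i)) ℝ (p i))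
    (he : Wallach.AreOrthonormal e)
    (ha : ∀ i, Wallach.wallachConstant e i = 1 / 6)
    (T : ℝ) (x : ℝ → Fin 3 → ℝ) (g : ℝ → Wallach.Metric n (G ⧸ H))
    (hg : ∀ t ∈ Ico (0 : ℝ) T, Wallach.IsInvariantMetric p (x t) (g t))
    (hflow : Wallach.IsNormalizedRicciFlow T g)
    (h0 : ∀ i j k : Fin 3, i ≠ j → j ≠ k → i ≠ k → x 0 k < x 0 i + x 0 j) :
    ∀ t ∈ Ico (0 : ℝ) T, Wallach.HasPositiveRicci (g t) :=
  theorem4_general H p hW.isWallachDecomposition e he (by norm_num [ha]) T x g hg hflow h0
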